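/- **Setting.** For $z\in\{1,2\}$, $k\ge 1$, let $\Sigma^{[k,z]}_{\rho_2}$ be the $k\times k$ matrix with unit diagonal and off-diagonal $(i,j)$ entry $\rho_2$ if $z=1$ (equicorrelation) and $\rho_2^{|i-j|}$ if $z=2$ (autoregressive), and let $$\Sigma^{[k,z]}_{\rho_1,\rho_2}=\begin{pmatrix}1&\rho_1\mathbf 1_k^{\mathrm T}\\ \rho_1\mathbf 1_k&\Sigma^{[k,z]}_{\rho_2}\end{pmatrix}.$$ Let $\Phi$ be the standard normal distribution function, $\Phi^{-1}:[0,1]\to[-\infty,\infty]$ its inverse, and let $C_\Sigma(u)=\Phi_\Sigma(\Phi^{-1}(u_1),\dots,\Phi^{-1}(u_d))$ be the Gaussian copula with correlation matrix $\Sigma$, with density $c_\Sigma(u)=(\det\Sigma)^{-1/2}\exp\!\big(-\tfrac12 q^{\mathrm T}(\Sigma^{-1}-I)q\big)$, $q=(\Phi^{-1}(u_1),\dots,\Phi^{-1}(u_d))^{\mathrm T}$, $u\in(0,1)^d$. Let $K\in\{1,2,\dots\}\cup\{\infty\}$ and $\rho_1,\rho_2\in(-1,1)$; if $z=1$ suppose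 $\rho_1^2<\rho_2$, and if $z=2$ suppose that $\Sigma^{[k,2]}_{\rho_1,\rho_2}$ is positive definite for all $k\le K$. Let $N^+$ be a non-degenerate positive-integer-valued random variable with distribution function $F_1^+$ and $N^+\le K$ almost surely (no restriction if $K=\infty$). Let $F_2$ be the distribution function of a non-negative random variable with probability density function $f_2$. Let $Y_1,Y_2,\dots$ be random variables such that for every positive integer $k\le K$ the vector $(N^+,Y_1,\dots,Y_k)$ has distribution function $C_{\Sigma^{[k,z]}_{\rho_1,\rho_2}}(F_1^+,F_2,\dots,F_2)$ (Gaussian-copula conditional model). Let $R$ be a Bernoulli random variable with success probability $p\in[0,1]$, independent of $(N^+,Y_1,\dots,Y_k)$ for every positive integer $k\le K$. Put $N=N^+$ if $R=1$ and $N=0$ if $R=0$; $\boldsymbol Y^{[n]}=(Y_1,\dots,Y_n)$; and let $(N,\boldsymbol Y^{[N]})$ be $(N,Y_1,\dots,Y_N)$ if $N\ge1$ and $0$ if $N=0$ (dependent collective risk model). **Theorem.** For each $z=1,2$, the joint density of $(N,\boldsymbol Y^{[N]})$, with respect to counting measure in $n$ and Lebesgue measure in $\boldsymbol y^{[n]}\in\mathbb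 R^n$ (a unit point mass when $n=0$), is $$h(n,\boldsymbol y^{[n]})=\begin{cases}p\,f_{\boldsymbol Y^{[n]}}(\boldsymbol y^{[n]})\left(\Phi\!\left(\dfrac{\Phi^{-1}(F_1^+(n))-\mu_{[n,z]}}{\sigma_{[n,z]}}\right)-\Phi\!\left(\dfrac{\Phi^{-1}(F_1^+(n-1))-\mu_{[n,z]}}{\sigma_{[n,z]}}\right)\right),&n\ge1,\\[2ex]1-p,&n=0,\end{cases}$$ where $\Phi(-\infty)=0$, $\Phi(\infty)=1$, $$f_{\boldsymbol Y^{[n]}}(y_1,\dots,y_n)=c_{\Sigma^{[n,z]}_{\rho_2}}(F_2(y_1),\dots,F_2(y_n))\prod_{i=1}^nf_2(y_i),$$ $$\mu_{[n,z]}=\rho_1\mathbf 1_n^{\mathrm T}\big(\Sigma^{[n,z]}_{\rho_2}\big)^{-1}\big(\Phi^{-1}(F_2(y_1)),\dots,\Phi^{-1}(F_2(y_n))\big)^{\mathrm T},\qquad \sigma_{[n,z]}=\sqrt{1-\rho_1^2\,\mathbf 1_n^{\mathrm T}\big(\Sigma^{[n,z]}_{\rho_2}\big)^{-1}\mathbf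 1_n};$$ and, for every positive integer $n\le K$, $f_{\boldsymbol Y^{[n]}}$ is the probability density function of $\boldsymbol Y^{[n]}$. (For $n>K$ the bracket is $0$ and so is $h$.) -/

import Mathlib

open MeasureTheory ProbabilityTheory

noncomputable section

namespace RiskModel

/-! ### Correlation matrices -/

/-- The two correlation structures among the severities: equicorrelation (`z = 1`)
and autoregressive (`z = 2`). -/
inductive CorrType
  | equi
  | autoreg

/-- The `k × k` correlation matrix of the severities: off-diagonal entries `ρ₂`
(equicorrelation), or `ρ₂ ^ |i - j|` (autoregressive). -/
def sevCorr (z : CorrType) (ρ₂ : ℝ) (k : ℕ) : Matrix (Fin k) (Fin k) ℝ :=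
  Matrix.of fun i j =>
    if i = j then 1
    else match z with
      | .equi => ρ₂
      | .autoreg => ρ₂ ^ ((i : ℤ) - (j : ℤ)).natAbs

/-- The `(k+1) × (k+1)` correlation matrix of the frequency (index `0`) and the severities
(indices `1, …, k`), that is `[[1, ρ₁ 1ᵀ], [ρ₁ 1, sevCorr z ρ₂ k]]`. -/
def jointCorr (z : CorrType) (ρ₁ ρ₂ : ℝ) (k : ℕ) : Matrix (Fin (k + 1)) (Fin (k + 1)) ℝ :=
  Matrix.of fun i j =>
    Fin.cases (motive := fun _ => ℝ)
      (Fin.cases (motive := fun _ => ℝ) 1 (fun _ => ρ₁) j)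
      (fun i' => Fin.cases (motive := fun _ => ℝ) ρ₁ (fun j' => sevCorr z ρ₂ k i' j') j)
      i

/-! ### Standard normal distribution function, quantile function, Gaussian copula -/

/-- The standard normal distribution function `Φ` on `[-∞, ∞]`, with `Φ(-∞) = 0`, `Φ(∞) = 1`. -/
def stdNormalCDF (x : EReal) : ℝ :=
  (gaussianReal 0 1).real {t : ℝ | (t : EReal) ≤ x}

/-- The standard normal quantile function `Φ⁻¹ : [0,1] → [-∞, ∞]`, with `Φ⁻¹(0) = -∞` and
`Φ⁻¹(1) = ∞`. -/
def stdNormalQuantile (u : ℝ) : EReal :=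
  sInf {x : EReal | u ≤ stdNormalCDF x}

/-- The Gaussian copula with correlation matrix `S`:
`C_S(u) = Φ_S(Φ⁻¹(u₁), …, Φ⁻¹(u_d))`, where `Φ_S` is the distribution function of the
centered multivariate normal distribution with covariance matrix `S`. -/
def gaussianCopula {ι : Type*} [Fintype ι] [DecidableEq ι] (S : Matrix ι ι ℝ) (u : ι → ℝ) : ℝ :=
  (multivariateGaussian 0 S).real {x | ∀ i, ((x i : ℝ) : EReal) ≤ stdNormalQuantile (u i)}

/-- The vector of normal scores `(Φ⁻¹(u₁), …, Φ⁻¹(u_d))`, for `u ∈ (0,1)^d`. -/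
def normalScores {ι : Type*} (u : ι → ℝ) : ι → ℝ :=
  fun i => (stdNormalQuantile (u i)).toReal

open Matrix in
/-- The density of the Gaussian copula with correlation matrix `S`: at `u ∈ (0,1)^d`, with
`q = (Φ⁻¹(u₁), …, Φ⁻¹(u_d))`, the ratio of the `N(0, S)` and the `N(0, I)` densities at `q`. -/
def gaussianCopulaDensity {ι : Type*} [Fintype ι] [DecidableEq ι] (S : Matrix ι ι ℝ)
    (u : ι → ℝ) : ℝ :=
  (Real.sqrt S.det)⁻¹ *
    Real.exp (-(1 / 2) * (normalScores u ⬝ᵥ ((S⁻¹ - 1) *ᵥ normalScores u)))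

/-! ### Marginal distributions -/

/-- The probability distribution on `ℝ` with density `f₂`. -/
def sevLaw (f₂ : ℝ → ℝ) : Measure ℝ :=
  volume.withDensity fun y => ENNReal.ofReal (f₂ y)

/-- `f₂` is a probability density function of a non-negative continuous distribution. -/
structure IsSevDensity (f₂ : ℝ → ℝ) : Prop where
  measurable : Measurable f₂
  nonneg : ∀ y, 0 ≤ f₂ y
  isProbabilityMeasure : IsProbabilityMeasure (sevLaw f₂)
  support_nonneg : sevLaw f₂ (Set.Iio 0) = 0

/-- The severity distribution function `F₂`. -/
def sevCDF (f₂ : ℝ → ℝ) (y : ℝ) : ℝ := cdf (sevLaw f₂) y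

/-- The distribution function `F₁⁺` of the positive frequency. -/
def freqCDF {Ω : Type*} [MeasurableSpace Ω] (P : Measure Ω) (Nplus : Ω → ℕ) (x : ℝ) : ℝ :=
  cdf (P.map fun ω => (Nplus ω : ℝ)) x

/-! ### The models -/

/-- The first `k` severities, `Y^[k] = (Y₁, …, Y_k)`; the sequence is indexed from `0`, so that
`Y i` is the severity of claim number `i + 1`. -/
def firstSev {Ω : Type*} (Y : ℕ → Ω → ℝ) (k : ℕ) (ω : Ω) : Fin k → ℝ := fun i => Y i ω

/-- The admissible parameters. `K` bounds the sizes `k` of the vectors `(N⁺, Y^[k])` in the model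
(`K = ⊤`: all sizes). In the equicorrelated case `ρ₁² < ρ₂ < 1` makes all
correlation matrices positive definite; in the autoregressive case positive definiteness does not
follow from `ρ₁, ρ₂ ∈ (-1, 1)` and is part of the model. -/
def AdmissibleParams (z : CorrType) (ρ₁ ρ₂ : ℝ) (K : ℕ∞) : Prop :=
  ρ₁ ∈ Set.Ioo (-1 : ℝ) 1 ∧ ρ₂ ∈ Set.Ioo (-1 : ℝ) 1 ∧
    match z with
    | .equi => ρ₁ ^ 2 < ρ₂
    | .autoreg => ∀ k : ℕ, (k : ℕ∞) ≤ K → (jointCorr .autoreg ρ₁ ρ₂ k).PosDef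

/-- The Gaussian-copula conditional model for the positive frequency `N⁺` and the severities: for
every positive integer `k` (at most `K`) the distribution function of `(N⁺, Y₁, …, Y_k)`
is `C_Σ(F₁⁺, F₂, …, F₂)`, with `C_Σ` the Gaussian copula with correlation matrix
`Σ = jointCorr z ρ₁ ρ₂ k`. -/
structure GaussianConditionalModel {Ω : Type*} [MeasurableSpace Ω] (P : Measure Ω)
    (z : CorrType) (ρ₁ ρ₂ : ℝ) (K : ℕ∞) (f₂ : ℝ → ℝ) (Nplus : Ω → ℕ) (Y : ℕ → Ω → ℝ) : Prop where
  admissible : AdmissibleParams z ρ₁ ρ₂ K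
  sevDensity : IsSevDensity f₂
  measurable_freq : Measurable Nplus
  measurable_sev : ∀ j, Measurable (Y j)
  freq_pos : ∀ᵐ ω ∂P, 1 ≤ Nplus ω
  freq_le : ∀ᵐ ω ∂P, (Nplus ω : ℕ∞) ≤ K
  freq_nondegenerate : ¬ ∃ m : ℕ, ∀ᵐ ω ∂P, Nplus ω = m
  joint_cdf : ∀ k : ℕ, 1 ≤ k → (k : ℕ∞) ≤ K → ∀ (x : ℝ) (y : Fin k → ℝ),
    P.real {ω | (Nplus ω : ℝ) ≤ x ∧ ∀ i, firstSev Y k ω i ≤ y i} =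
      gaussianCopula (jointCorr z ρ₁ ρ₂ k)
        (Fin.cons (freqCDF P Nplus x) fun i => sevCDF f₂ (y i))

/-- The hurdle part of the dependent collective risk model: `R` is Bernoulli with success
probability `p` and is independent of `(N⁺, Y₁, …, Y_k)` for every positive `k` (at most `K`). -/
structure BernoulliHurdle {Ω : Type*} [MeasurableSpace Ω] (P : Measure Ω)
    (p : unitInterval) (K : ℕ∞) (R : Ω → ℕ) (Nplus : Ω → ℕ) (Y : ℕ → Ω → ℝ) : Prop where
  measurable : Measurable R
  bernoulli : HasLaw R (bernoulliMeasure 1 0 p) P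
  indep : ∀ k : ℕ, 1 ≤ k → (k : ℕ∞) ≤ K →
    IndepFun R (fun ω => (Nplus ω, firstSev Y k ω)) P

/-- The frequency `N`, equal to `N⁺` if `R = 1` and to `0` otherwise. -/
def freq {Ω : Type*} (R Nplus : Ω → ℕ) (ω : Ω) : ℕ := if R ω = 1 then Nplus ω else 0

/-- The dependent collective risk model `(N, Y^[N]) = (N, Y₁, …, Y_N)`, a random element of the
disjoint union of the spaces `ℝⁿ`, `n = 0, 1, 2, …` (`ℝ⁰` is a single point). -/
def riskVector {Ω : Type*} (R Nplus : Ω → ℕ) (Y : ℕ → Ω → ℝ) (ω : Ω) : Σ n : ℕ, (Fin n → ℝ) :=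
  ⟨freq R Nplus ω, firstSev Y (freq R Nplus ω) ω⟩

/-! ### Densities -/

/-- `h` is a density, with respect to `ν`, of the law of the random element `X`. -/
structure IsDensityOf {Ω E : Type*} [MeasurableSpace Ω] [MeasurableSpace E] (h : E → ℝ)
    (X : Ω → E) (P : Measure Ω) (ν : Measure E) : Prop where
  measurable : Measurable h
  nonneg : ∀ e, 0 ≤ h e
  hasLaw : HasLaw X (ν.withDensity fun e => ENNReal.ofReal (h e)) P

/-- The reference measure for a joint density of a discrete margin `n` and continuous margins
`y ∈ ℝⁿ`: counting measure in `n`, and Lebesgue measure in `y` (a unit point mass on `ℝ⁰`). -/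
def mixedVolume : Measure (Σ n : ℕ, (Fin n → ℝ)) :=
  Measure.sum fun n => (volume : Measure (Fin n → ℝ)).map (Sigma.mk n)

/-- `f_{Y^[k]}(y) = c_Σ(F₂(y₁), …, F₂(y_k)) ∏ f₂(yᵢ)` with `Σ = sevCorr z ρ₂ k`. -/
def sevJointDensity (z : CorrType) (ρ₂ : ℝ) (f₂ : ℝ → ℝ) (k : ℕ) (y : Fin k → ℝ) : ℝ :=
  gaussianCopulaDensity (sevCorr z ρ₂ k) (fun i => sevCDF f₂ (y i)) * ∏ i, f₂ (y i)

open Matrix in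
/-- `μ_[k,z] = (ρ₁ 1ᵀ) Σ⁻¹ (Φ⁻¹(F₂(y₁)), …, Φ⁻¹(F₂(y_k)))ᵀ` with `Σ = sevCorr z ρ₂ k`. -/
def condMean (z : CorrType) (ρ₁ ρ₂ : ℝ) (f₂ : ℝ → ℝ) (k : ℕ) (y : Fin k → ℝ) : ℝ :=
  (fun _ : Fin k => ρ₁) ⬝ᵥ ((sevCorr z ρ₂ k)⁻¹ *ᵥ normalScores fun i => sevCDF f₂ (y i))

open Matrix in
/-- `σ_[k,z] = √(1 - (ρ₁ 1ᵀ) Σ⁻¹ (ρ₁ 1))` with `Σ = sevCorr z ρ₂ k`. -/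
def condSD (z : CorrType) (ρ₁ ρ₂ : ℝ) (k : ℕ) : ℝ :=
  Real.sqrt (1 - (fun _ : Fin k => ρ₁) ⬝ᵥ ((sevCorr z ρ₂ k)⁻¹ *ᵥ fun _ : Fin k => ρ₁))

/-- `Φ((Φ⁻¹(F₁⁺(x)) - μ_[k,z]) / σ_[k,z])`, where `F₁` stands for `F₁⁺`; the quotient is taken in
`[-∞, ∞]`, since `F₁⁺(x)` may be `0` or `1`. -/
def condFreqCDF (z : CorrType) (ρ₁ ρ₂ : ℝ) (F₁ : ℝ → ℝ) (f₂ : ℝ → ℝ) (k : ℕ) (x : ℝ)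
    (y : Fin k → ℝ) : ℝ :=
  stdNormalCDF ((stdNormalQuantile (F₁ x) - (condMean z ρ₁ ρ₂ f₂ k y : EReal)) /
    (condSD z ρ₁ ρ₂ k : EReal))

/-- The mixed density `h_{N⁺, Y^[k]}(n, y)` of the Gaussian-copula conditional model. -/
def mixedDensity (z : CorrType) (ρ₁ ρ₂ : ℝ) (F₁ : ℝ → ℝ) (f₂ : ℝ → ℝ) (k : ℕ) (n : ℕ)
    (y : Fin k → ℝ) : ℝ :=
  sevJointDensity z ρ₂ f₂ k y *
    (condFreqCDF z ρ₁ ρ₂ F₁ f₂ k (n : ℝ) y - condFreqCDF z ρ₁ ρ₂ F₁ f₂ k ((n : ℝ) - 1) y)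

/-- The claimed joint density: `1 - p` at `n = 0`, and `p · h_{N⁺, Y^[n]}(n, y)` for `n ≥ 1`. -/
def riskDensity (z : CorrType) (ρ₁ ρ₂ : ℝ) (p : unitInterval) (F₁ : ℝ → ℝ) (f₂ : ℝ → ℝ)
    (v : Σ n : ℕ, (Fin n → ℝ)) : ℝ :=
  if v.1 = 0 then 1 - (p : ℝ) else (p : ℝ) * mixedDensity z ρ₁ ρ₂ F₁ f₂ v.1 v.1 v.2

end RiskModel

end

noncomputable section

namespace RiskModel

open Filter Topology
open scoped Matrix

/-! ### The standard normal distribution function and its quantile function -/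

/-! Let `(G₀, G')` be centred normal with covariance `jointCorr z ρ₁ ρ₂ k`, and write `T` for the
covariance of `G'` and `r = ρ₁ 1`. Regression of `G₀` on `G'` gives `G₀ = r ⬝ᵥ T⁻¹ G' + σ Z` with
`Z` standard normal and independent of `G'` (`multivariateGaussian_eq_map_prod`). So the copula at
`(u, F₂(y₁), …, F₂(y_k))` is an integral over the law of `G'` of `Φ((Φ⁻¹(u) - μ) / σ)`. This law has
density `gaussianRatio T` with respect to the standard normal law (`map_ofLp_multivariateGaussian`),
which in turn is the image of the product of the severity laws under the normal scores
(`map_normalScore`). Pulling back along the scores, with no differentiation of `F₂` or `Φ⁻¹`, writes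
the joint distribution function as an integral of `f_Y · Φ((Φ⁻¹(u) - μ) / σ)` over a lower box
(`gaussianCopula_cons_eq_lintegral`).

Lower boxes determine a finite measure, so this identifies the law of `Y^[k]` on each event `{N⁺ ≤
x}`. The difference between `x = n` and `x = n - 1` gives the mixed density on `{N⁺ = n}`; letting
`x` tend to infinity gives the density of `Y^[k]`. Independence of `R` contributes the factor `p`,
and the law of `(N, Y^[N])` is assembled by summing over the values of `N`, with `k = n` on `{N =
n}`. -/

lemma measurableSet_coe_le (x : EReal) : MeasurableSet {t : ℝ | (t : EReal) ≤ x} :=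
  measurableSet_le measurable_coe_real_ereal measurable_const

lemma stdNormalCDF_mono : Monotone stdNormalCDF := fun _ _ h =>
  measureReal_mono fun _ ht => le_trans (α := EReal) ht h

lemma stdNormalCDF_nonneg (x : EReal) : 0 ≤ stdNormalCDF x := measureReal_nonneg

lemma stdNormalCDF_le_one (x : EReal) : stdNormalCDF x ≤ 1 := measureReal_le_one

lemma stdNormalCDF_top : stdNormalCDF ⊤ = 1 := by simp [stdNormalCDF]

lemma stdNormalCDF_bot : stdNormalCDF ⊥ = 0 := by simp [stdNormalCDF]

lemma stdNormalCDF_coe (x : ℝ) : stdNormalCDF x = cdf (gaussianReal 0 1) x := by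
  rw [cdf_eq_real]; simp [stdNormalCDF, Set.Iic]

/-- The jump of the distribution function at a point is the mass of that point, which is zero here.
-/
lemma continuous_cdf (μ : Measure ℝ) [IsProbabilityMeasure μ] [NullSingletonClass μ] :
    Continuous (cdf μ) := by
  rw [continuous_iff_continuousAt]
  intro x
  have hleft : Function.leftLim (cdf μ) x = cdf μ x := by
    have h := (cdf μ).measure_singleton x
    rw [measure_cdf, measure_singleton, eq_comm, ENNReal.ofReal_eq_zero, sub_nonpos] at h
    exact le_antisymm ((monotone_cdf μ).leftLim_le le_rfl) h
  rw [continuousAt_iff_continuous_left'_right']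
  exact ⟨(monotone_cdf μ).continuousWithinAt_Iio_iff_leftLim_eq.2 hleft,
    ((cdf μ).right_continuous x).mono Set.Ioi_subset_Ici_self⟩

lemma cdf_gaussianReal_lt_one (x : ℝ) : cdf (gaussianReal 0 1) x < 1 := by
  refine lt_of_le_of_ne (cdf_le_one _ _) fun h => ?_
  have h1 : gaussianReal 0 1 (Set.Iic x) = 1 := by rw [← ofReal_cdf, h, ENNReal.ofReal_one]
  have h0 := (prob_compl_eq_zero_iff measurableSet_Iic).2 h1
  simpa using gaussianReal_absolutelyContinuous' 0 one_ne_zero h0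

lemma cdf_gaussianReal_pos (x : ℝ) : 0 < cdf (gaussianReal 0 1) x := by
  refine lt_of_le_of_ne (cdf_nonneg _ _) fun h => ?_
  have h0 : gaussianReal 0 1 (Set.Iic x) = 0 := by rw [← ofReal_cdf, ← h, ENNReal.ofReal_zero]
  simpa using gaussianReal_absolutelyContinuous' 0 one_ne_zero h0

/-- Right continuity on `[-∞, ∞]`, from continuity of measure along a sequence decreasing to `x`. At
`x = ⊤` the hypothesis `h` is vacuous, and `hu` takes over. -/
lemma le_stdNormalCDF_of_forall_gt {u : ℝ} {x : EReal} (hu : u ≤ 1)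
    (h : ∀ y, x < y → u ≤ stdNormalCDF y) : u ≤ stdNormalCDF x := by
  rcases eq_or_ne x ⊤ with rfl | hx
  · rwa [stdNormalCDF_top]
  obtain ⟨v, hv, hv', hlim⟩ := exists_seq_strictAnti_tendsto' (lt_top_iff_ne_top.2 hx)
  have hset : {t : ℝ | (t : EReal) ≤ x} = ⋂ n, {t : ℝ | (t : EReal) ≤ v n} := by
    ext t
    simp only [Set.mem_ofPred_eq, Set.mem_iInter]
    exact ⟨fun ht n => ht.trans (hv' n).1.le, fun ht => ge_of_tendsto' hlim ht⟩
  have hanti : Antitone fun n => {t : ℝ | (t : EReal) ≤ v n} := fun m n hmn t ht =>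
    le_trans (α := EReal) ht (hv.antitone hmn)
  have htend : Tendsto (fun n => stdNormalCDF (v n)) atTop (𝓝 (stdNormalCDF x)) := by
    simp only [stdNormalCDF, measureReal_def, hset]
    refine (ENNReal.tendsto_toReal (measure_ne_top _ _)).comp
      (tendsto_measure_iInter_atTop (fun n => (measurableSet_coe_le _).nullMeasurableSet) hanti
        ⟨0, measure_ne_top _ _⟩)
  exact ge_of_tendsto' htend fun n => h _ (hv' n).1

/-- The Galois connection between quantile and distribution function: right continuity makes the
infimum defining the quantile attained. -/
lemma stdNormalQuantile_le_iff {u : ℝ} (hu : u ≤ 1) (x : EReal) :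
    stdNormalQuantile u ≤ x ↔ u ≤ stdNormalCDF x := by
  refine ⟨fun h => le_stdNormalCDF_of_forall_gt hu fun y hy => ?_, fun h => sInf_le h⟩
  obtain ⟨w, hw, hwy⟩ := sInf_lt_iff.1 (h.trans_lt hy)
  exact le_trans (α := ℝ) hw (stdNormalCDF_mono hwy.le)

lemma stdNormalQuantile_mono : Monotone stdNormalQuantile := fun _ _ h =>
  sInf_le_sInf fun _ hx => h.trans hx

lemma exists_cdf_gaussianReal_eq {u : ℝ} (h0 : 0 < u) (h1 : u < 1) :
    ∃ x : ℝ, cdf (gaussianReal 0 1) x = u := by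
  have : NullSingletonClass (gaussianReal 0 1) := nullSingletonClass_gaussianReal one_ne_zero
  obtain ⟨a, ha⟩ := ((tendsto_cdf_atBot (gaussianReal 0 1)).eventually (gt_mem_nhds h0)).exists
  obtain ⟨b, hb⟩ := ((tendsto_cdf_atTop (gaussianReal 0 1)).eventually (lt_mem_nhds h1)).exists
  exact mem_range_of_exists_le_of_exists_ge (continuous_cdf _) ⟨a, ha.le⟩ ⟨b, hb.le⟩

lemma stdNormalCDF_quantile {u : ℝ} (h0 : 0 ≤ u) (h1 : u ≤ 1) :
    stdNormalCDF (stdNormalQuantile u) = u := by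
  refine le_antisymm ?_ ((stdNormalQuantile_le_iff h1 _).1 le_rfl)
  rcases h0.eq_or_lt with rfl | h0
  · have : stdNormalQuantile 0 ≤ ⊥ := (stdNormalQuantile_le_iff h1 _).2 (stdNormalCDF_nonneg _)
    rw [le_bot_iff.1 this, stdNormalCDF_bot]
  rcases h1.eq_or_lt with rfl | h1
  · exact stdNormalCDF_le_one _
  obtain ⟨x, hx⟩ := exists_cdf_gaussianReal_eq h0 h1
  rw [← stdNormalCDF_coe] at hx
  exact (stdNormalCDF_mono ((stdNormalQuantile_le_iff h1.le _).2 hx.ge)).trans hx.le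

lemma coe_toReal_stdNormalQuantile {u : ℝ} (h0 : 0 < u) (h1 : u < 1) :
    (((stdNormalQuantile u).toReal : ℝ) : EReal) = stdNormalQuantile u := by
  refine EReal.coe_toReal (fun h => ?_) (fun h => ?_)
  · have := stdNormalCDF_quantile h0.le h1.le
    rw [h, stdNormalCDF_top] at this
    linarith
  · have := stdNormalCDF_quantile h0.le h1.le
    rw [h, stdNormalCDF_bot] at this
    linarith

/-! ### The probability integral transform -/

/-- Flat stretches of a distribution function carry no mass: `μ (Ioc y x) = 0` for each `x` in the
stretch. If the stretch has a largest point, one such interval covers it; otherwise each of its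
points has such an interval as a neighbourhood, and a locally null set is null. -/
lemma measure_Ioi_inter_cdf_eq (μ : Measure ℝ) [IsProbabilityMeasure μ] (y : ℝ) :
    μ (Set.Ioi y ∩ {x | cdf μ x = cdf μ y}) = 0 := by
  have hIoc : ∀ x ∈ Set.Ioi y ∩ {x | cdf μ x = cdf μ y}, μ (Set.Ioc y x) = 0 := by
    rintro x ⟨hx, hxy⟩
    have := (cdf μ).measure_Ioc y x
    rw [measure_cdf] at this
    rw [this, hxy, sub_self, ENNReal.ofReal_zero]
  by_cases hmax : ∃ z ∈ Set.Ioi y ∩ {x | cdf μ x = cdf μ y},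
      ∀ x ∈ Set.Ioi y ∩ {x | cdf μ x = cdf μ y}, x ≤ z
  · obtain ⟨z, hz, hle⟩ := hmax
    exact measure_mono_null (t := Set.Ioc y z) (fun x hx => ⟨hx.1, hle x hx⟩) (hIoc z hz)
  · push Not at hmax
    refine measure_null_of_locally_null _ fun x hx => ?_
    obtain ⟨w, hw, hxw⟩ := hmax x hx
    exact ⟨Set.Ioc y w, mem_nhdsWithin_of_mem_nhds (Ioc_mem_nhds hx.1 hxw), hIoc w hw⟩

/-- The probability integral transform. By continuity `u = cdf μ y` for some `y`, and the event
differs from `Iic y` only by a flat stretch to the right of `y`. -/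
lemma measure_cdf_le (μ : Measure ℝ) [IsProbabilityMeasure μ] [NullSingletonClass μ] {u : ℝ}
    (h0 : 0 < u) (h1 : u < 1) : μ {x | cdf μ x ≤ u} = ENNReal.ofReal u := by
  obtain ⟨a, ha⟩ := ((tendsto_cdf_atBot μ).eventually (gt_mem_nhds h0)).exists
  obtain ⟨b, hb⟩ := ((tendsto_cdf_atTop μ).eventually (lt_mem_nhds h1)).exists
  obtain ⟨y, rfl⟩ := mem_range_of_exists_le_of_exists_ge (continuous_cdf μ) ⟨a, ha.le⟩ ⟨b, hb.le⟩
  rw [ofReal_cdf]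
  refine measure_congr ?_
  rw [ae_eq_set]
  refine ⟨measure_mono_null ?_ (measure_Ioi_inter_cdf_eq μ y), ?_⟩
  · rintro x ⟨hx, hxy⟩
    have hxy : y < x := not_le.1 hxy
    exact ⟨hxy, le_antisymm hx (monotone_cdf μ hxy.le)⟩
  · have hsub : Set.Iic y ⊆ {x | cdf μ x ≤ cdf μ y} := fun x hx => monotone_cdf μ hx
    rw [Set.sdiff_eq_empty.2 hsub, measure_empty]

lemma ae_cdf_pos (μ : Measure ℝ) [IsProbabilityMeasure μ] [NullSingletonClass μ] :
    ∀ᵐ x ∂μ, 0 < cdf μ x := by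
  rw [ae_iff]
  have h : ∀ᶠ u in 𝓝[>] (0 : ℝ), μ {x | ¬0 < cdf μ x} ≤ ENNReal.ofReal u := by
    filter_upwards [Ioo_mem_nhdsGT (zero_lt_one' ℝ)] with u hu
    rw [← measure_cdf_le μ hu.1 hu.2]
    exact measure_mono fun x hx => (not_lt.1 hx).trans hu.1.le
  have hlim : Tendsto ENNReal.ofReal (𝓝[>] (0 : ℝ)) (𝓝 0) := by
    simpa using (ENNReal.tendsto_ofReal (tendsto_id (x := 𝓝 (0 : ℝ)))).mono_left
      nhdsWithin_le_nhds
  exact le_antisymm (ge_of_tendsto hlim h) bot_le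

lemma ae_cdf_lt_one (μ : Measure ℝ) [IsProbabilityMeasure μ] [NullSingletonClass μ] :
    ∀ᵐ x ∂μ, cdf μ x < 1 := by
  rw [ae_iff]
  have h : ∀ᶠ u in 𝓝[<] (1 : ℝ), μ {x | ¬cdf μ x < 1} ≤ 1 - ENNReal.ofReal u := by
    filter_upwards [Ioo_mem_nhdsLT (zero_lt_one' ℝ)] with u hu
    rw [← measure_cdf_le μ hu.1 hu.2, ← prob_compl_eq_one_sub
      (measurableSet_le (monotone_cdf μ).measurable measurable_const)]
    exact measure_mono fun x hx => not_le.2 (hu.2.trans_le (not_lt.1 hx))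
  have hlim : Tendsto (fun u => 1 - ENNReal.ofReal u) (𝓝[<] (1 : ℝ)) (𝓝 0) := by
    have := ENNReal.Tendsto.sub (tendsto_const_nhds (x := (1 : ENNReal)))
      ((ENNReal.tendsto_ofReal (tendsto_id (x := 𝓝 (1 : ℝ)))).mono_left nhdsWithin_le_nhds)
      (Or.inl ENNReal.one_ne_top) (f := 𝓝[<] (1 : ℝ))
    simpa using this
  exact le_antisymm (ge_of_tendsto hlim h) bot_le

/-- The normal score of `y` with respect to the distribution `μ`. -/
def normalScore (μ : Measure ℝ) (y : ℝ) : ℝ := (stdNormalQuantile (cdf μ y)).toReal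

lemma measurable_normalScore (μ : Measure ℝ) : Measurable (normalScore μ) :=
  (stdNormalQuantile_mono.comp (monotone_cdf μ)).measurable.ereal_toReal

/-- A score is at most `t` exactly when the uniform variable `cdf μ y` is at most `Φ(t)`. The points
with `cdf μ y ∈ {0, 1}`, where `toReal` turns an infinite quantile into `0`, form a null set. -/
lemma map_normalScore (μ : Measure ℝ) [IsProbabilityMeasure μ] [NullSingletonClass μ] :
    μ.map (normalScore μ) = gaussianReal 0 1 := by
  have := Measure.isProbabilityMeasure_map (μ := μ) (measurable_normalScore μ).aemeasurable
  refine Measure.ext_of_Iic _ _ fun t => ?_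
  rw [Measure.map_apply (measurable_normalScore μ) measurableSet_Iic, ← ofReal_cdf,
    ← measure_cdf_le μ (cdf_gaussianReal_pos t) (cdf_gaussianReal_lt_one t)]
  refine measure_congr ?_
  filter_upwards [ae_cdf_pos μ, ae_cdf_lt_one μ] with y h0 h1
  refine propext ?_
  change normalScore μ y ≤ t ↔ cdf μ y ≤ _
  rw [← stdNormalCDF_coe, ← stdNormalQuantile_le_iff h1.le, ← EReal.coe_le_coe_iff, normalScore,
    coe_toReal_stdNormalQuantile h0 h1]

/-- Lets the box in score space be replaced by a box in the severities. Apart from infinite scores,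
the equivalence can fail only on the flat stretch to the right of `y`, which is null even if `cdf μ`
is not injective. -/
lemma normalScore_le_quantile_ae (μ : Measure ℝ) [IsProbabilityMeasure μ] [NullSingletonClass μ]
    (y : ℝ) :
    ∀ᵐ x ∂μ, (normalScore μ x : EReal) ≤ stdNormalQuantile (cdf μ y) ↔ x ≤ y := by
  have hnull : ∀ᵐ x ∂μ, x ∉ Set.Ioi y ∩ {x | cdf μ x = cdf μ y} :=
    measure_eq_zero_iff_ae_notMem.1 (measure_Ioi_inter_cdf_eq μ y)
  filter_upwards [ae_cdf_pos μ, ae_cdf_lt_one μ, hnull] with x h0 h1 hx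
  rw [normalScore, coe_toReal_stdNormalQuantile h0 h1, stdNormalQuantile_le_iff h1.le,
    stdNormalCDF_quantile (cdf_nonneg μ y) (cdf_le_one μ y)]
  refine ⟨fun h => not_lt.1 fun hlt => hx ⟨hlt, ?_⟩, fun h => monotone_cdf μ h⟩
  exact le_antisymm h (monotone_cdf μ hlt.le)

/-! ### Densities of product measures and of Gaussian vectors -/

lemma pi_withDensity {ι : Type*} [Fintype ι] {f : ℝ → ℝ} (hf : Integrable f)
    (h0 : ∀ x, 0 ≤ f x) [SigmaFinite (volume.withDensity fun x => ENNReal.ofReal (f x))] :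
    Measure.pi (fun _ : ι => volume.withDensity fun x => ENNReal.ofReal (f x)) =
      volume.withDensity fun y : ι → ℝ => ENNReal.ofReal (∏ i, f (y i)) := by
  refine Measure.pi_eq fun s hs => ?_
  have hind : ∀ y : ι → ℝ, (Set.univ.pi s).indicator
      (fun y => ENNReal.ofReal (∏ i, f (y i))) y =
        ENNReal.ofReal (∏ i, (s i).indicator f (y i)) := by
    intro y
    by_cases hy : y ∈ Set.univ.pi s
    · rw [Set.indicator_of_mem hy]
      congr 1
      exact Finset.prod_congr rfl fun i _ => (Set.indicator_of_mem (hy i trivial) _).symm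
    · rw [Set.indicator_of_notMem hy]
      simp only [Set.mem_pi, Set.mem_univ, true_imp_iff, not_forall] at hy
      obtain ⟨i, hi⟩ := hy
      rw [Finset.prod_eq_zero (Finset.mem_univ i) (Set.indicator_of_notMem hi _),
        ENNReal.ofReal_zero]
  have hint : ∀ i, Integrable ((s i).indicator f) := fun i => hf.indicator (hs i)
  have hnn : ∀ i x, 0 ≤ (s i).indicator f x := fun i => Set.indicator_nonneg fun x _ => h0 x
  rw [withDensity_apply _ (MeasurableSet.univ_pi hs),
    ← lintegral_indicator (MeasurableSet.univ_pi hs)]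
  simp_rw [hind]
  rw [volume_pi, ← ofReal_integral_eq_lintegral_ofReal (Integrable.fintype_prod hint)
      (ae_of_all _ fun y => Finset.prod_nonneg fun i _ => hnn i _),
    integral_fintype_prod_eq_prod, ENNReal.ofReal_prod_of_nonneg
      fun i _ => integral_nonneg (hnn i)]
  refine Finset.prod_congr rfl fun i _ => ?_
  rw [withDensity_apply _ (hs i), ← lintegral_indicator (hs i),
    ofReal_integral_eq_lintegral_ofReal (hint i) (ae_of_all _ (hnn i))]
  refine lintegral_congr fun x => ?_
  by_cases hx : x ∈ s i <;> simp [hx]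

/-- The ratio of the `N(0, S)` and the `N(0, I)` densities. -/
def gaussianRatio {ι : Type*} [Fintype ι] [DecidableEq ι] (S : Matrix ι ι ℝ) (q : ι → ℝ) : ℝ :=
  (Real.sqrt S.det)⁻¹ * Real.exp (-(1 / 2) * (q ⬝ᵥ ((S⁻¹ - 1) *ᵥ q)))

lemma gaussianRatio_nonneg {ι : Type*} [Fintype ι] [DecidableEq ι] (S : Matrix ι ι ℝ)
    (q : ι → ℝ) : 0 ≤ gaussianRatio S q := by
  unfold gaussianRatio; positivity

lemma continuous_gaussianRatio {ι : Type*} [Fintype ι] [DecidableEq ι] (S : Matrix ι ι ℝ) :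
    Continuous (gaussianRatio S) := by
  unfold gaussianRatio; fun_prop

lemma pi_gaussianReal (ι : Type*) [Fintype ι] :
    Measure.pi (fun _ : ι => gaussianReal 0 1) =
      volume.withDensity fun y : ι → ℝ => ENNReal.ofReal (∏ i, gaussianPDFReal 0 1 (y i)) := by
  have h : gaussianReal 0 1 = volume.withDensity fun x => ENNReal.ofReal (gaussianPDFReal 0 1 x) :=
    gaussianReal_of_var_ne_zero 0 one_ne_zero
  have : IsProbabilityMeasure (volume.withDensity fun x =>
    ENNReal.ofReal (gaussianPDFReal 0 1 x)) := h ▸ inferInstance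
  rw [h, pi_withDensity (integrable_gaussianPDFReal 0 1) (gaussianPDFReal_nonneg 0 1)]

lemma prod_gaussianPDFReal {ι : Type*} [Fintype ι] (q : ι → ℝ) :
    ∏ i, gaussianPDFReal 0 1 (q i) =
      ((Real.sqrt (2 * Real.pi))⁻¹) ^ Fintype.card ι * Real.exp (-(1 / 2) * (q ⬝ᵥ q)) := by
  simp only [gaussianPDFReal, Finset.prod_mul_distrib, Finset.prod_const, Finset.card_univ,
    NNReal.coe_one, mul_one, sub_zero, ← Real.exp_sum]
  congr 2
  rw [dotProduct, Finset.mul_sum]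
  exact Finset.sum_congr rfl fun i _ => by ring

/-- Linear change of variables. Since `S = A Aᵀ`, the form of `S⁻¹` at `A q` is `q ⬝ᵥ q`, and the
Jacobian `|det A|` cancels `√(det S)`. -/
lemma map_mulVec_pi_gaussianReal {ι : Type*} [Fintype ι] [DecidableEq ι] {A S : Matrix ι ι ℝ}
    (hA : A * Aᵀ = S) (hS : S.det ≠ 0) :
    (Measure.pi fun _ : ι => gaussianReal 0 1).map (fun q => A *ᵥ q) =
      (Measure.pi fun _ : ι => gaussianReal 0 1).withDensity
        fun q => ENNReal.ofReal (gaussianRatio S q) := by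
  have hdet : A.det * A.det = S.det := by rw [← hA, Matrix.det_mul, Matrix.det_transpose]
  have hA0 : A.det ≠ 0 := fun h => hS (by rw [← hdet, h, mul_zero])
  have hAu : IsUnit A.det := hA0.isUnit
  have hmeas : Measurable fun q : ι → ℝ => A *ᵥ q := by fun_prop
  have hprodm : Measurable fun y : ι → ℝ => ENNReal.ofReal (∏ i, gaussianPDFReal 0 1 (y i)) := by
    fun_prop
  have hratm : Measurable fun y : ι → ℝ => ENNReal.ofReal (gaussianRatio S y) :=
    (continuous_gaussianRatio S).measurable.ennreal_ofReal
  have hvol : (volume : Measure (ι → ℝ)) =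
      ENNReal.ofReal |A.det| • (volume : Measure (ι → ℝ)).map (fun q => A *ᵥ q) := by
    have := Measure.map_linearMap_addHaar_eq_smul_addHaar (volume : Measure (ι → ℝ))
      (f := Matrix.toLin' A) (by rwa [LinearMap.det_toLin'])
    rw [LinearMap.det_toLin'] at this
    have h2 : ⇑(Matrix.toLin' A) = fun q => A *ᵥ q := by ext; simp
    rw [h2] at this
    rw [this, smul_smul, ← ENNReal.ofReal_mul (abs_nonneg _), ← abs_mul, mul_inv_cancel₀ hA0]
    simp
  have hquad : ∀ q : ι → ℝ, (A *ᵥ q) ⬝ᵥ ((S⁻¹ - 1) *ᵥ (A *ᵥ q)) =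
      q ⬝ᵥ q - (A *ᵥ q) ⬝ᵥ (A *ᵥ q) := by
    intro q
    rw [Matrix.sub_mulVec, Matrix.one_mulVec, dotProduct_sub]
    congr 1
    rw [← hA, Matrix.mul_inv_rev, Matrix.mulVec_mulVec, Matrix.mul_assoc,
      Matrix.nonsing_inv_mul _ hAu, Matrix.mul_one, Matrix.dotProduct_mulVec,
      ← Matrix.mulVec_transpose, Matrix.transpose_nonsing_inv, Matrix.transpose_transpose,
      Matrix.mulVec_mulVec, Matrix.nonsing_inv_mul _ hAu, Matrix.one_mulVec]
  -- The change-of-variables identity for densities: Jacobian times the `N(0, S)` density at `A q`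
  -- is the `N(0, I)` density at `q`.
  have hkey : ∀ q : ι → ℝ, ENNReal.ofReal |A.det| *
      (ENNReal.ofReal (∏ i, gaussianPDFReal 0 1 ((A *ᵥ q) i)) *
        ENNReal.ofReal (gaussianRatio S (A *ᵥ q))) =
      ENNReal.ofReal (∏ i, gaussianPDFReal 0 1 (q i)) := by
    intro q
    rw [← ENNReal.ofReal_mul (Finset.prod_nonneg fun i _ => gaussianPDFReal_nonneg 0 1 _),
      ← ENNReal.ofReal_mul (abs_nonneg _)]
    congr 1
    rw [prod_gaussianPDFReal, prod_gaussianPDFReal, gaussianRatio, hquad, ← hdet,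
      Real.sqrt_mul_self_eq_abs]
    have habs : |A.det| ≠ 0 := abs_ne_zero.2 hA0
    have hexp : Real.exp (-(1 / 2) * (q ⬝ᵥ q)) =
        Real.exp (-(1 / 2) * ((A *ᵥ q) ⬝ᵥ (A *ᵥ q))) *
          Real.exp (-(1 / 2) * (q ⬝ᵥ q - (A *ᵥ q) ⬝ᵥ (A *ᵥ q))) := by
      rw [← Real.exp_add]; congr 1; ring
    rw [hexp]
    field_simp
  ext B hB
  rw [Measure.map_apply hmeas hB, pi_gaussianReal, ← withDensity_mul _ hprodm hratm,
    withDensity_apply _ (hmeas hB), withDensity_apply _ hB]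
  conv_rhs => rw [hvol]
  rw [Measure.restrict_smul, lintegral_smul_measure, setLIntegral_map hB (hprodm.mul hratm) hmeas]
  simp only [Pi.mul_apply]
  rw [smul_eq_mul, ← lintegral_const_mul' _ _ ENNReal.ofReal_ne_top]
  exact lintegral_congr fun q => (hkey q).symm

open scoped MatrixOrder in
-- The Gaussian vector is the symmetric square root of `S` applied to a standard one, so the
-- preceding change of variables applies with `A = √S`.
lemma map_ofLp_multivariateGaussian {ι : Type*} [Fintype ι] [DecidableEq ι] {S : Matrix ι ι ℝ}
    (hS : S.PosDef) :
    (multivariateGaussian 0 S).map WithLp.ofLp =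
      (Measure.pi fun _ : ι => gaussianReal 0 1).withDensity
        fun q => ENNReal.ofReal (gaussianRatio S q) := by
  have hsqrt : CFC.sqrt S * (CFC.sqrt S)ᵀ = S := by
    have hsa : (CFC.sqrt S)ᵀ = CFC.sqrt S := by
      have := (CFC.sqrt_nonneg S).isSelfAdjoint.star_eq
      rwa [Matrix.star_eq_conjTranspose, Matrix.conjTranspose_eq_transpose_of_trivial] at this
    rw [hsa, CFC.sqrt_mul_sqrt_self _ hS.posSemidef.nonneg]
  rw [← map_mulVec_pi_gaussianReal hsqrt hS.det_pos.ne', multivariateGaussian,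
    ← map_pi_eq_stdGaussian, Measure.map_map (by fun_prop) (by fun_prop),
    Measure.map_map (by fun_prop) (by fun_prop)]
  congr 1
  ext q i
  simp

/-! ### Conditioning a Gaussian vector on all but one coordinate -/

/-- Regression of the first coordinate on the others, with residual variance the Schur complement `s
^ 2`. It is proved by comparing characteristic functions, which reduces it to an identity of
quadratic forms. -/
lemma multivariateGaussian_eq_map_prod {k : ℕ} {S : Matrix (Fin (k + 1)) (Fin (k + 1)) ℝ}
    (hS : S.PosDef) {T : Matrix (Fin k) (Fin k) ℝ} (hT : T.PosDef) {r : Fin k → ℝ} {s : ℝ}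
    (h00 : S 0 0 = 1) (h0s : ∀ j, S 0 (Fin.succ j) = r j) (hs0 : ∀ j, S (Fin.succ j) 0 = r j)
    (hss : ∀ i j, S (Fin.succ i) (Fin.succ j) = T i j)
    (hs : s ^ 2 = 1 - r ⬝ᵥ (T⁻¹ *ᵥ r)) :
    multivariateGaussian 0 S = ((multivariateGaussian 0 T).prod (gaussianReal 0 1)).map
      fun x => WithLp.toLp 2 (Fin.cons (r ⬝ᵥ (T⁻¹ *ᵥ WithLp.ofLp x.1) + s * x.2)
        (WithLp.ofLp x.1)) := by
  have hmeas : Measurable fun x : EuclideanSpace ℝ (Fin k) × ℝ =>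
      (WithLp.toLp 2 (Fin.cons (r ⬝ᵥ (T⁻¹ *ᵥ WithLp.ofLp x.1) + s * x.2)
        (WithLp.ofLp x.1) : Fin (k + 1) → ℝ) : EuclideanSpace ℝ (Fin (k + 1))) := by
    refine (WithLp.measurable_toLp 2 _).comp (measurable_pi_iff.2 fun i => ?_)
    refine Fin.cases ?_ (fun j => ?_) i
    · simp only [Fin.cons_zero]
      fun_prop
    · simp only [Fin.cons_succ]
      fun_prop
  have := Measure.isProbabilityMeasure_map
    (μ := (multivariateGaussian 0 T).prod (gaussianReal 0 1)) hmeas.aemeasurable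
  have hTu : IsUnit T.det := hT.det_pos.ne'.isUnit
  have hTt : T⁻¹ᵀ = T⁻¹ := by
    have := hT.inv.isHermitian.eq
    rwa [Matrix.conjTranspose_eq_transpose_of_trivial] at this
  refine Measure.ext_of_charFun ?_
  ext t
  rw [charFun_multivariateGaussian hS.posSemidef, charFun_apply,
    integral_map hmeas.aemeasurable (by fun_prop)]
  -- The coefficient vector of the last `k` coordinates once the regression term `t 0 * (r ⬝ᵥ T⁻¹
  -- x)` is moved onto them by symmetry of `T⁻¹`.
  set u : EuclideanSpace ℝ (Fin k) :=
    WithLp.toLp 2 ((fun j => t (Fin.succ j)) + t 0 • (T⁻¹ *ᵥ r)) with hu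
  have hsplit : ∀ x : EuclideanSpace ℝ (Fin k) × ℝ,
      inner ℝ (WithLp.toLp 2 (Fin.cons (r ⬝ᵥ (T⁻¹ *ᵥ WithLp.ofLp x.1) + s * x.2)
        (WithLp.ofLp x.1) : Fin (k + 1) → ℝ)) t = inner ℝ x.1 u + inner ℝ x.2 (s * t 0) := by
    intro x
    have hx : r ⬝ᵥ (T⁻¹ *ᵥ WithLp.ofLp x.1) = WithLp.ofLp x.1 ⬝ᵥ (T⁻¹ *ᵥ r) := by
      rw [Matrix.dotProduct_mulVec, ← Matrix.mulVec_transpose, hTt, dotProduct_comm]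
    simp only [EuclideanSpace.inner_eq_star_dotProduct, star_trivial, hu, hx, RCLike.inner_apply, conj_trivial, add_dotProduct, smul_dotProduct]
    simp only [dotProduct, Fin.sum_univ_succ, Fin.cons_zero, Fin.cons_succ, smul_eq_mul,
      mul_comm (x.1.ofLp _)]
    have haux : ∀ a b c d e : ℝ, a * (b + c * d) + e = e + a * b + c * a * d := by
      intros; ring
    exact haux _ _ _ _ _
  simp_rw [hsplit, Complex.ofReal_add, add_mul, Complex.exp_add]
  rw [integral_prod_mul (fun x => Complex.exp ((inner ℝ x u : ℝ) * Complex.I))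
    (fun x => Complex.exp ((inner ℝ x (s * t 0) : ℝ) * Complex.I)), ← charFun_apply,
    ← charFun_apply, charFun_multivariateGaussian hT.posSemidef, charFun_gaussianReal,
    ← Complex.exp_add]
  congr 1
  -- Completing the square: the form of `T` at `u` contributes an extra `(t 0)² r ⬝ᵥ T⁻¹ r`, which
  -- `hs` combines with `(s * t 0) ^ 2` into `(t 0)²`.
  have hquad : (WithLp.ofLp t) ⬝ᵥ (S *ᵥ WithLp.ofLp t) =
      WithLp.ofLp u ⬝ᵥ (T *ᵥ WithLp.ofLp u) + (s * t 0) ^ 2 := by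
    have hcross : ∀ v : Fin k → ℝ, (T⁻¹ *ᵥ r) ⬝ᵥ (T *ᵥ v) = r ⬝ᵥ v := by
      intro v
      rw [dotProduct_comm, dotProduct_comm r, Matrix.dotProduct_mulVec, ← Matrix.mulVec_transpose,
        hTt, Matrix.mulVec_mulVec, Matrix.nonsing_inv_mul _ hTu, Matrix.one_mulVec]
    have hback : T *ᵥ (T⁻¹ *ᵥ r) = r := by
      rw [Matrix.mulVec_mulVec, Matrix.mul_nonsing_inv _ hTu, Matrix.one_mulVec]
    have hS0 : (S *ᵥ WithLp.ofLp t) 0 = t 0 + r ⬝ᵥ fun j => t (Fin.succ j) := by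
      simp [Matrix.mulVec, dotProduct, Fin.sum_univ_succ, h00, h0s]
    have hSs : ∀ i, (S *ᵥ WithLp.ofLp t) (Fin.succ i) =
        r i * t 0 + (T *ᵥ fun j => t (Fin.succ j)) i := by
      intro i
      simp [Matrix.mulVec, dotProduct, Fin.sum_univ_succ, hs0, hss]
    have hleft : (WithLp.ofLp t) ⬝ᵥ (S *ᵥ WithLp.ofLp t) =
        t 0 * (t 0 + r ⬝ᵥ fun j => t (Fin.succ j)) + (r ⬝ᵥ fun j => t (Fin.succ j)) * t 0 +
          (fun j => t (Fin.succ j)) ⬝ᵥ (T *ᵥ fun j => t (Fin.succ j)) := by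
      conv_lhs => rw [dotProduct, Fin.sum_univ_succ, hS0]
      simp only [hSs, mul_add, Finset.sum_add_distrib]
      rw [dotProduct, dotProduct, Finset.sum_mul]
      simp only [mul_left_comm]
      ring_nf
    rw [hleft, hu, mul_pow, hs]
    simp only [Matrix.mulVec_add, Matrix.mulVec_smul, hback, add_dotProduct, dotProduct_add,
      smul_dotProduct, dotProduct_smul, hcross, smul_eq_mul]
    rw [dotProduct_comm (T⁻¹ *ᵥ r) r, dotProduct_comm (fun j => t (Fin.succ j)) r]
    ring
  rw [hquad]
  push_cast
  simp
  ring_nf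

/-! ### Positive definiteness of the correlation matrices -/

lemma sevCorr_transpose (z : CorrType) (ρ₂ : ℝ) (k : ℕ) : (sevCorr z ρ₂ k)ᵀ = sevCorr z ρ₂ k := by
  ext i j
  have h : ((j : ℤ) - (i : ℤ)).natAbs = ((i : ℤ) - (j : ℤ)).natAbs := by omega
  cases z <;> simp [sevCorr, h, eq_comm]

lemma jointCorr_submatrix_succ (z : CorrType) (ρ₁ ρ₂ : ℝ) (k : ℕ) :
    (jointCorr z ρ₁ ρ₂ k).submatrix Fin.succ Fin.succ = sevCorr z ρ₂ k := by
  ext i j; simp [jointCorr]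

lemma jointCorr_mulVec_cons (z : CorrType) (ρ₁ ρ₂ : ℝ) (k : ℕ) (a : ℝ) (v : Fin k → ℝ) :
    jointCorr z ρ₁ ρ₂ k *ᵥ (Fin.cons a v : Fin (k + 1) → ℝ) =
      Fin.cons (a + (fun _ => ρ₁) ⬝ᵥ v) (fun i => ρ₁ * a + (sevCorr z ρ₂ k *ᵥ v) i) := by
  ext i
  refine Fin.cases ?_ (fun i => ?_) i <;>
    simp [jointCorr, Matrix.mulVec, dotProduct, Fin.sum_univ_succ]

lemma dotProduct_jointCorr_cons (z : CorrType) (ρ₁ ρ₂ : ℝ) (k : ℕ) (a : ℝ) (v : Fin k → ℝ) :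
    (Fin.cons a v : Fin (k + 1) → ℝ) ⬝ᵥ
        (jointCorr z ρ₁ ρ₂ k *ᵥ (Fin.cons a v : Fin (k + 1) → ℝ)) =
      a ^ 2 + 2 * a * ((fun _ => ρ₁) ⬝ᵥ v) + v ⬝ᵥ (sevCorr z ρ₂ k *ᵥ v) := by
  rw [jointCorr_mulVec_cons]
  simp only [dotProduct, Fin.sum_univ_succ, Fin.cons_zero, Fin.cons_succ, mul_add,
    Finset.sum_add_distrib]
  have h : ∑ i, v i * (ρ₁ * a) = a * ∑ i, ρ₁ * v i := by
    rw [Finset.mul_sum]; exact Finset.sum_congr rfl fun i _ => by ring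
  rw [h]; ring

lemma jointCorr_isHermitian (z : CorrType) (ρ₁ ρ₂ : ℝ) (k : ℕ) :
    (jointCorr z ρ₁ ρ₂ k).IsHermitian := by
  rw [Matrix.IsHermitian, Matrix.conjTranspose_eq_transpose_of_trivial]
  ext i j
  refine Fin.cases (Fin.cases ?_ (fun j => ?_) j) (fun i => Fin.cases ?_ (fun j => ?_) j) i
  · simp [jointCorr]
  · simp [jointCorr]
  · simp [jointCorr]
  · have := congrFun (congrFun (sevCorr_transpose z ρ₂ k) i) j
    simpa [jointCorr] using this

lemma sevCorr_equi_mulVec (ρ₂ : ℝ) (k : ℕ) (v : Fin k → ℝ) (i : Fin k) :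
    (sevCorr .equi ρ₂ k *ᵥ v) i = (1 - ρ₂) * v i + ρ₂ * ∑ j, v j := by
  have h : ∀ j, sevCorr .equi ρ₂ k i j * v j = (if i = j then (1 - ρ₂) * v j else 0) + ρ₂ * v j := by
    intro j
    by_cases hij : i = j <;> simp [sevCorr, hij]
    ring
  simp only [Matrix.mulVec, dotProduct, h, Finset.sum_add_distrib, Finset.mul_sum]
  simp

/-- The quadratic form at `(a, v)` is `(a + ρ₁ ∑ v)² + (ρ₂ - ρ₁²)(∑ v)² + (1 - ρ₂) ∑ v²`. The last
term is positive unless `v = 0`, and then `a² > 0` remains. -/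
lemma posDef_jointCorr_equi {ρ₁ ρ₂ : ℝ} (h2 : ρ₂ < 1) (h : ρ₁ ^ 2 < ρ₂) (k : ℕ) :
    (jointCorr .equi ρ₁ ρ₂ k).PosDef := by
  refine .of_dotProduct_mulVec_pos (jointCorr_isHermitian _ _ _ _) fun x hx => ?_
  rw [star_trivial, ← Fin.cons_self_tail x, dotProduct_jointCorr_cons]
  set a := x 0
  set v := Fin.tail x with hv
  have h1 : (fun _ => ρ₁) ⬝ᵥ v = ρ₁ * ∑ j, v j := by simp [dotProduct, Finset.mul_sum]
  have h3 : v ⬝ᵥ (sevCorr .equi ρ₂ k *ᵥ v) = (1 - ρ₂) * ∑ j, v j ^ 2 + ρ₂ * (∑ j, v j) ^ 2 := by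
    simp only [dotProduct, sevCorr_equi_mulVec, mul_add, Finset.sum_add_distrib]
    have h4 : ∑ i, v i * ((1 - ρ₂) * v i) = (1 - ρ₂) * ∑ i, v i ^ 2 := by
      rw [Finset.mul_sum]; exact Finset.sum_congr rfl fun i _ => by ring
    rw [← Finset.sum_mul, h4]
    ring
  rw [h1, h3]
  have hs : 0 ≤ ∑ j, v j ^ 2 := Finset.sum_nonneg fun i _ => sq_nonneg _
  have hid : a ^ 2 + 2 * a * (ρ₁ * ∑ j, v j) + ((1 - ρ₂) * ∑ j, v j ^ 2 + ρ₂ * (∑ j, v j) ^ 2) =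
      (a + ρ₁ * ∑ j, v j) ^ 2 + (ρ₂ - ρ₁ ^ 2) * (∑ j, v j) ^ 2 + (1 - ρ₂) * ∑ j, v j ^ 2 := by ring
  rw [hid]
  have hA : 0 ≤ (ρ₂ - ρ₁ ^ 2) * (∑ j, v j) ^ 2 := mul_nonneg (sub_nonneg.2 h.le) (sq_nonneg _)
  rcases hs.eq_or_lt with h0 | hpos
  · have hv0 : v = 0 := by
      ext i
      have := (Finset.sum_eq_zero_iff_of_nonneg fun i _ => sq_nonneg (v i)).1 h0.symm i
        (Finset.mem_univ i)
      simpa using this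
    have ha : a ≠ 0 := by
      intro ha
      refine hx (funext fun i => Fin.cases ha (fun j => ?_) i)
      exact congrFun hv0 j
    have : 0 < a ^ 2 := by positivity
    simpa [hv0] using this
  · have : 0 < (1 - ρ₂) * ∑ j, v j ^ 2 := mul_pos (sub_pos.2 h2) hpos
    positivity

lemma AdmissibleParams.posDef_jointCorr {z : CorrType} {ρ₁ ρ₂ : ℝ} {K : ℕ∞}
    (h : AdmissibleParams z ρ₁ ρ₂ K) {k : ℕ} (hk : (k : ℕ∞) ≤ K) :
    (jointCorr z ρ₁ ρ₂ k).PosDef := by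
  cases z with
  | equi => exact posDef_jointCorr_equi h.2.1.2 h.2.2 k
  | autoreg => exact h.2.2 k hk

lemma posDef_sevCorr {z : CorrType} {ρ₁ ρ₂ : ℝ} {k : ℕ} (h : (jointCorr z ρ₁ ρ₂ k).PosDef) :
    (sevCorr z ρ₂ k).PosDef := by
  rw [← jointCorr_submatrix_succ z ρ₁]
  exact h.submatrix (Fin.succ_injective k)

/-- The Schur complement is the value of the joint quadratic form at the nonzero vector `(1, -T⁻¹
r)`. -/
lemma condVar_pos {z : CorrType} {ρ₁ ρ₂ : ℝ} {k : ℕ} (h : (jointCorr z ρ₁ ρ₂ k).PosDef) :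
    0 < 1 - (fun _ : Fin k => ρ₁) ⬝ᵥ ((sevCorr z ρ₂ k)⁻¹ *ᵥ fun _ : Fin k => ρ₁) := by
  set w := (sevCorr z ρ₂ k)⁻¹ *ᵥ fun _ : Fin k => ρ₁ with hw
  have hx : (Fin.cons 1 (-w) : Fin (k + 1) → ℝ) ≠ 0 := fun h0 => by
    simpa using congrFun h0 0
  have hpos := h.dotProduct_mulVec_pos hx
  have hTw : sevCorr z ρ₂ k *ᵥ w = fun _ => ρ₁ := by
    rw [hw, Matrix.mulVec_mulVec, Matrix.mul_nonsing_inv _ (posDef_sevCorr h).det_pos.ne'.isUnit,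
      Matrix.one_mulVec]
  rw [star_trivial, dotProduct_jointCorr_cons, Matrix.mulVec_neg, hTw, neg_dotProduct_neg,
    dotProduct_neg, dotProduct_comm w] at hpos
  linarith

lemma condSD_pos {z : CorrType} {ρ₁ ρ₂ : ℝ} {k : ℕ} (h : (jointCorr z ρ₁ ρ₂ k).PosDef) :
    0 < condSD z ρ₁ ρ₂ k := Real.sqrt_pos.2 (condVar_pos h)

/-! ### The copula model as an integral -/

lemma IsSevDensity.integrable {f₂ : ℝ → ℝ} (h : IsSevDensity f₂) : Integrable f₂ := by
  refine ⟨h.measurable.aestronglyMeasurable, ?_⟩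
  have := h.isProbabilityMeasure.measure_univ
  rw [sevLaw, withDensity_apply _ MeasurableSet.univ, Measure.restrict_univ] at this
  rw [hasFiniteIntegral_iff_ofReal (ae_of_all _ h.nonneg), this]
  exact ENNReal.one_lt_top

instance (f₂ : ℝ → ℝ) : NullSingletonClass (sevLaw f₂) := by
  unfold sevLaw; infer_instance

lemma gaussianReal_affine_le {s : ℝ} (hs : 0 < s) (m : ℝ) (a : EReal) :
    gaussianReal 0 1 {t : ℝ | ((m + s * t : ℝ) : EReal) ≤ a} =
      ENNReal.ofReal (stdNormalCDF ((a - (m : EReal)) / (s : EReal))) := by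
  rw [stdNormalCDF, ofReal_measureReal]
  congr 1
  ext t
  simp only [Set.mem_ofPred_eq]
  rw [EReal.le_div_iff_mul_le (EReal.coe_pos.2 hs) (EReal.coe_ne_top s),
    EReal.le_sub_iff_add_le (Or.inl (EReal.coe_ne_bot m)) (Or.inl (EReal.coe_ne_top m)),
    ← EReal.coe_mul, ← EReal.coe_add, add_comm, mul_comm]

lemma antitone_stdNormalCDF_sub_div (a : EReal) {s : ℝ} (hs : 0 ≤ s) :
    Antitone fun m : ℝ => stdNormalCDF ((a - (m : EReal)) / (s : EReal)) := fun _ _ h =>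
  stdNormalCDF_mono (EReal.monotone_div_right_of_nonneg (EReal.coe_nonneg.2 hs)
    (EReal.sub_le_sub le_rfl (EReal.coe_le_coe_iff.2 h)))

lemma measurable_scores (f₂ : ℝ → ℝ) (k : ℕ) :
    Measurable fun (y : Fin k → ℝ) i => normalScore (sevLaw f₂) (y i) :=
  measurable_pi_iff.2 fun i => (measurable_normalScore _).comp (measurable_pi_apply i)

/-- The analytic core: condition the first Gaussian coordinate on the others, then transport the
remaining integral from score space to the severities. -/
lemma gaussianCopula_cons_eq_lintegral {z : CorrType} {ρ₁ ρ₂ : ℝ} {k : ℕ}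
    (hS : (jointCorr z ρ₁ ρ₂ k).PosDef) {f₂ : ℝ → ℝ} (hf : IsSevDensity f₂) (u : ℝ)
    (y : Fin k → ℝ) :
    ENNReal.ofReal (gaussianCopula (jointCorr z ρ₁ ρ₂ k)
        (Fin.cons u fun i => sevCDF f₂ (y i))) =
      ∫⁻ y' in Set.univ.pi fun i => Set.Iic (y i),
        ENNReal.ofReal (sevJointDensity z ρ₂ f₂ k y' *
          stdNormalCDF ((stdNormalQuantile u - (condMean z ρ₁ ρ₂ f₂ k y' : EReal)) /
            (condSD z ρ₁ ρ₂ k : EReal))) := by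
  have := hf.isProbabilityMeasure
  set T := sevCorr z ρ₂ k with hTdef
  have hT : T.PosDef := posDef_sevCorr hS
  set s := condSD z ρ₁ ρ₂ k with hsdef
  have hs : 0 < s := condSD_pos hS
  set a := stdNormalQuantile u
  let m : (Fin k → ℝ) → ℝ := fun q => (fun _ => ρ₁) ⬝ᵥ (T⁻¹ *ᵥ q)
  have hm : Measurable m := by unfold m; fun_prop
  let B : Set (Fin k → ℝ) := {q | ∀ i, (q i : EReal) ≤ stdNormalQuantile (sevCDF f₂ (y i))}
  have hB : MeasurableSet B := by
    have : B = Set.univ.pi fun i => {t : ℝ | (t : EReal) ≤ stdNormalQuantile (sevCDF f₂ (y i))} := by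
      ext q; simp [B]
    rw [this]
    exact MeasurableSet.univ_pi fun i => measurableSet_coe_le _
  let Φc : (Fin k → ℝ) → ENNReal := fun q =>
    ENNReal.ofReal (stdNormalCDF ((a - (m q : EReal)) / (s : EReal)))
  have hΦc : Measurable Φc :=
    ((antitone_stdNormalCDF_sub_div a hs.le).measurable.comp hm).ennreal_ofReal
  have hrat : Measurable fun q => ENNReal.ofReal (gaussianRatio T q) :=
    (continuous_gaussianRatio T).measurable.ennreal_ofReal
  have hprod : Measurable fun y : Fin k → ℝ => ENNReal.ofReal (∏ i, f₂ (y i)) := by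
    have := hf.measurable
    fun_prop
  let Ψ : (Fin k → ℝ) → Fin k → ℝ := fun y i => normalScore (sevLaw f₂) (y i)
  have hΨ : Measurable Ψ := measurable_scores f₂ k
  have hmap : (Measure.pi fun _ : Fin k => sevLaw f₂).map Ψ =
      Measure.pi fun _ => gaussianReal 0 1 := by
    have : ∀ _ : Fin k, SigmaFinite ((sevLaw f₂).map (normalScore (sevLaw f₂))) := fun _ => by
      rw [map_normalScore]; infer_instance
    rw [Measure.pi_map_pi fun _ => (measurable_normalScore (sevLaw f₂)).aemeasurable]
    simp_rw [map_normalScore]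
  have hpi : (Measure.pi fun _ : Fin k => sevLaw f₂) =
      volume.withDensity fun y : Fin k → ℝ => ENNReal.ofReal (∏ i, f₂ (y i)) := by
    have : SigmaFinite (volume.withDensity fun x => ENNReal.ofReal (f₂ x)) :=
      inferInstanceAs (SigmaFinite (sevLaw f₂))
    exact pi_withDensity hf.integrable hf.nonneg
  have hbox : MeasurableSet (Set.univ.pi fun i => Set.Iic (y i)) :=
    MeasurableSet.univ_pi fun i => measurableSet_Iic
  have hae : (Ψ ⁻¹' B : Set (Fin k → ℝ)) =ᵐ[Measure.pi fun _ : Fin k => sevLaw f₂]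
      Set.univ.pi fun i => Set.Iic (y i) := by
    have h : ∀ᵐ y' ∂(Measure.pi fun _ : Fin k => sevLaw f₂), ∀ i,
        ((Ψ y' i : ℝ) : EReal) ≤ stdNormalQuantile (sevCDF f₂ (y i)) ↔ y' i ≤ y i :=
      ae_all_iff.2 fun i => (Measure.tendsto_eval_ae_ae (μ := fun _ : Fin k => sevLaw f₂)
        (i := i)).eventually (normalScore_le_quantile_ae (sevLaw f₂) (y i))
    filter_upwards [h] with y' hy'
    refine propext ?_
    change (∀ i, _) ↔ ∀ i ∈ Set.univ, _
    simp only [Set.mem_univ, true_imp_iff]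
    exact forall_congr' hy'
  have hpair : Measurable fun x : EuclideanSpace ℝ (Fin k) × ℝ =>
      (WithLp.toLp 2 (Fin.cons (m (WithLp.ofLp x.1) + s * x.2)
        (WithLp.ofLp x.1) : Fin (k + 1) → ℝ) : EuclideanSpace ℝ (Fin (k + 1))) := by
    refine (WithLp.measurable_toLp 2 _).comp (measurable_pi_iff.2 fun i => ?_)
    refine Fin.cases ?_ (fun j => ?_) i
    · simp only [Fin.cons_zero]
      fun_prop
    · simp only [Fin.cons_succ]
      fun_prop
  let A : Set (EuclideanSpace ℝ (Fin (k + 1))) := {x | ∀ i, ((x i : ℝ) : EReal) ≤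
    stdNormalQuantile ((Fin.cons u fun i => sevCDF f₂ (y i) : Fin (k + 1) → ℝ) i)}
  have hA : MeasurableSet A := by
    have : A = ⋂ i, (fun x : EuclideanSpace ℝ (Fin (k + 1)) => x i) ⁻¹' {t : ℝ | (t : EReal) ≤
        stdNormalQuantile ((Fin.cons u fun i => sevCDF f₂ (y i) : Fin (k + 1) → ℝ) i)} := by
      ext; simp [A]
    rw [this]
    exact MeasurableSet.iInter fun i => (measurableSet_coe_le _).preimage (by fun_prop)
  calc ENNReal.ofReal (gaussianCopula (jointCorr z ρ₁ ρ₂ k) (Fin.cons u fun i => sevCDF f₂ (y i)))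
      = multivariateGaussian 0 (jointCorr z ρ₁ ρ₂ k) A := ofReal_measureReal
    _ = ∫⁻ x, gaussianReal 0 1 (Prod.mk x ⁻¹' ((fun x : EuclideanSpace ℝ (Fin k) × ℝ =>
          (WithLp.toLp 2 (Fin.cons (m (WithLp.ofLp x.1) + s * x.2)
            (WithLp.ofLp x.1) : Fin (k + 1) → ℝ) : EuclideanSpace ℝ (Fin (k + 1)))) ⁻¹' A))
          ∂(multivariateGaussian 0 T) := by
        rw [multivariateGaussian_eq_map_prod hS hT (r := fun _ => ρ₁) (s := s)
          (by simp [jointCorr]) (by simp [jointCorr]) (by simp [jointCorr]) (by simp [jointCorr, T])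
          (Real.sq_sqrt (condVar_pos hS).le), Measure.map_apply hpair hA,
          Measure.prod_apply (hpair hA)]
    _ = ∫⁻ x, B.indicator Φc (WithLp.ofLp x) ∂(multivariateGaussian 0 T) := by
        refine lintegral_congr fun x => ?_
        -- The fibre of `A` over `x` is a half-line in the residual variable if the severity scores
        -- lie in `B`, and empty otherwise.
        by_cases hx : WithLp.ofLp x ∈ B
        · rw [Set.indicator_of_mem hx]
          refine Eq.trans ?_ (gaussianReal_affine_le hs (m (WithLp.ofLp x)) a)
          congr 1
          ext t
          simp only [A, Set.mem_preimage, Set.mem_ofPred_eq, Fin.forall_fin_succ, Fin.cons_zero,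
            Fin.cons_succ]
          exact ⟨fun h => h.1, fun h => ⟨h, hx⟩⟩
        · rw [Set.indicator_of_notMem hx]
          refine measure_mono_null (t := ∅) (fun t ht => hx ?_) measure_empty
          intro i
          simpa using ht (Fin.succ i)
    _ = ∫⁻ q, B.indicator Φc q ∂((multivariateGaussian 0 T).map WithLp.ofLp) :=
        (lintegral_map (hΦc.indicator hB) (by fun_prop)).symm
    -- Change of measure from `N(0, T)` to `N(0, I)`, the latter read as the image of the product
    -- severity law under the scores.
    _ = ∫⁻ q, ENNReal.ofReal (gaussianRatio T q) * B.indicator Φc q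
          ∂((Measure.pi fun _ : Fin k => sevLaw f₂).map Ψ) := by
        rw [map_ofLp_multivariateGaussian hT, hmap,
          lintegral_withDensity_eq_lintegral_mul _ hrat (hΦc.indicator hB)]
        rfl
    _ = ∫⁻ y' in Ψ ⁻¹' B, ENNReal.ofReal (gaussianRatio T (Ψ y')) * Φc (Ψ y')
          ∂(Measure.pi fun _ : Fin k => sevLaw f₂) := by
        have hmul : Measurable fun q => ENNReal.ofReal (gaussianRatio T q) * B.indicator Φc q :=
          hrat.mul (hΦc.indicator hB)
        rw [lintegral_map hmul hΨ, ← lintegral_indicator (hΨ hB)]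
        refine lintegral_congr fun y' => ?_
        by_cases hy' : Ψ y' ∈ B
        · rw [Set.indicator_of_mem hy', Set.indicator_of_mem (Set.mem_preimage.2 hy')]
        · rw [Set.indicator_of_notMem hy', Set.indicator_of_notMem (by simpa using hy'), mul_zero]
    _ = ∫⁻ y' in Set.univ.pi fun i => Set.Iic (y i),
          ENNReal.ofReal (gaussianRatio T (Ψ y')) * Φc (Ψ y')
          ∂(Measure.pi fun _ : Fin k => sevLaw f₂) := setLIntegral_congr hae
    _ = _ := by
        have hmul : Measurable fun y' => ENNReal.ofReal (gaussianRatio T (Ψ y')) * Φc (Ψ y') :=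
          (hrat.comp hΨ).mul (hΦc.comp hΨ)
        rw [hpi, setLIntegral_withDensity_eq_setLIntegral_mul _ hprod hmul hbox]
        refine lintegral_congr fun y' => ?_
        have h1 := gaussianRatio_nonneg T (Ψ y')
        have h2 : 0 ≤ ∏ i, f₂ (y' i) := Finset.prod_nonneg fun i _ => hf.nonneg _
        simp only [Pi.mul_apply, Φc]
        rw [← ENNReal.ofReal_mul h1, ← ENNReal.ofReal_mul h2]
        congr 1
        -- By definition the copula density at `F₂(y')` is `gaussianRatio T` at the scores, and `m
        -- (Ψ y')` is `condMean`.
        change _ = gaussianRatio T (Ψ y') * (∏ i, f₂ (y' i)) *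
          stdNormalCDF ((a - (m (Ψ y') : EReal)) / (s : EReal))
        ring

/-! ### The joint law of the positive frequency and the severities -/

/-- Lower boxes form a generating π-system, and the boxes `(-∞, n]^ι` exhaust the space, so
finiteness of `μ` alone suffices. -/
lemma ext_of_pi_Iic {ι : Type*} [Fintype ι] {μ ν : Measure (ι → ℝ)} [IsFiniteMeasure μ]
    (h : ∀ y : ι → ℝ, μ (Set.univ.pi fun i => Set.Iic (y i)) =
      ν (Set.univ.pi fun i => Set.Iic (y i))) : μ = ν := by
  have hgen : ∀ _ : ι, MeasurableSpace.generateFrom (Set.range (Set.Iic : ℝ → Set ℝ)) =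
      (inferInstance : MeasurableSpace ℝ) := fun _ => by
    rw [← borel_eq_generateFrom_Iic, ← BorelSpace.measurable_eq]
  have hspan : ∀ _ : ι, IsCountablySpanning (Set.range (Set.Iic : ℝ → Set ℝ)) := fun _ =>
    ⟨fun n => Set.Iic (n : ℝ), fun n => ⟨n, rfl⟩, Set.eq_univ_of_forall fun x =>
      Set.mem_iUnion.2 (exists_nat_ge x)⟩
  refine Measure.ext_of_generateFrom_of_iUnion
    (Set.univ.pi '' Set.univ.pi fun _ : ι => Set.range (Set.Iic : ℝ → Set ℝ))
    (fun n : ℕ => Set.univ.pi fun _ : ι => Set.Iic (n : ℝ)) (generateFrom_eq_pi hgen hspan).symm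
    (IsPiSystem.pi fun _ => ?_) ?_ (fun n => ?_) (fun n => measure_ne_top _ _) ?_
  · rintro _ ⟨a, rfl⟩ _ ⟨b, rfl⟩ _
    exact ⟨a ⊓ b, Set.Iic_inter_Iic.symm⟩
  · refine Set.eq_univ_of_forall fun x => Set.mem_iUnion.2 ?_
    obtain ⟨n, hn⟩ := exists_nat_ge (∑ i, |x i|)
    refine ⟨n, fun i _ => ?_⟩
    exact (le_abs_self _).trans
      ((Finset.single_le_sum (fun j _ => abs_nonneg (x j)) (Finset.mem_univ i)).trans hn)
  · exact ⟨fun _ => Set.Iic (n : ℝ), fun _ _ => ⟨n, rfl⟩, rfl⟩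
  · rintro _ ⟨s, hs, rfl⟩
    choose y hy using fun i => hs i trivial
    have : s = fun i => Set.Iic (y i) := funext fun i => (hy i).symm
    rw [this, h]

lemma measurable_sevJointDensity (z : CorrType) (ρ₂ : ℝ) {f₂ : ℝ → ℝ} (hf : Measurable f₂)
    (k : ℕ) : Measurable (sevJointDensity z ρ₂ f₂ k) := by
  have h := (continuous_gaussianRatio (sevCorr z ρ₂ k)).measurable.comp (measurable_scores f₂ k)
  have h2 : Measurable fun y : Fin k → ℝ => ∏ i, f₂ (y i) := by fun_prop
  exact h.mul h2

lemma sevJointDensity_nonneg (z : CorrType) (ρ₂ : ℝ) {f₂ : ℝ → ℝ} (hf : ∀ y, 0 ≤ f₂ y)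
    (k : ℕ) (y : Fin k → ℝ) : 0 ≤ sevJointDensity z ρ₂ f₂ k y :=
  mul_nonneg (gaussianRatio_nonneg _ _) (Finset.prod_nonneg fun _ _ => hf _)

lemma measurable_condMean (z : CorrType) (ρ₁ ρ₂ : ℝ) (f₂ : ℝ → ℝ) (k : ℕ) :
    Measurable (condMean z ρ₁ ρ₂ f₂ k) := by
  have h : Measurable fun q : Fin k → ℝ =>
      (fun _ : Fin k => ρ₁) ⬝ᵥ ((sevCorr z ρ₂ k)⁻¹ *ᵥ q) := by fun_prop
  exact h.comp (measurable_scores f₂ k)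

lemma measurable_condFreqCDF (z : CorrType) (ρ₁ ρ₂ : ℝ) (F₁ f₂ : ℝ → ℝ) (k : ℕ) (x : ℝ) :
    Measurable (condFreqCDF z ρ₁ ρ₂ F₁ f₂ k x) :=
  (antitone_stdNormalCDF_sub_div _ (Real.sqrt_nonneg _)).measurable.comp
    (measurable_condMean z ρ₁ ρ₂ f₂ k)

lemma condFreqCDF_mono (z : CorrType) (ρ₁ ρ₂ : ℝ) {F₁ : ℝ → ℝ} (hF : Monotone F₁) (f₂ : ℝ → ℝ)
    (k : ℕ) (y : Fin k → ℝ) : Monotone fun x => condFreqCDF z ρ₁ ρ₂ F₁ f₂ k x y := fun _ _ h =>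
  stdNormalCDF_mono (EReal.monotone_div_right_of_nonneg (EReal.coe_nonneg.2 (Real.sqrt_nonneg _))
    (EReal.sub_le_sub (stdNormalQuantile_mono (hF h)) le_rfl))

lemma mixedDensity_nonneg (z : CorrType) (ρ₁ ρ₂ : ℝ) {F₁ : ℝ → ℝ} (hF : Monotone F₁) {f₂ : ℝ → ℝ}
    (hf : ∀ y, 0 ≤ f₂ y) (k n : ℕ) (y : Fin k → ℝ) : 0 ≤ mixedDensity z ρ₁ ρ₂ F₁ f₂ k n y :=
  mul_nonneg (sevJointDensity_nonneg z ρ₂ hf k y)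
    (sub_nonneg.2 (condFreqCDF_mono z ρ₁ ρ₂ hF f₂ k y (sub_le_self _ zero_le_one)))

lemma measurable_mixedDensity (z : CorrType) (ρ₁ ρ₂ : ℝ) (F₁ : ℝ → ℝ) {f₂ : ℝ → ℝ}
    (hf : Measurable f₂) (k n : ℕ) : Measurable (mixedDensity z ρ₁ ρ₂ F₁ f₂ k n) :=
  (measurable_sevJointDensity z ρ₂ hf k).mul
    ((measurable_condFreqCDF z ρ₁ ρ₂ F₁ f₂ k n).sub (measurable_condFreqCDF z ρ₁ ρ₂ F₁ f₂ k _))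

lemma tendsto_stdNormalQuantile {α : Type*} {l : Filter α} {u : α → ℝ} (hu : ∀ x, u x ≤ 1)
    (h : Tendsto u l (𝓝 1)) : Tendsto (fun x => stdNormalQuantile (u x)) l (𝓝 ⊤) := by
  rw [EReal.tendsto_nhds_top_iff_real]
  intro M
  filter_upwards [h.eventually (lt_mem_nhds (cdf_gaussianReal_lt_one M))] with x hx
  rw [← stdNormalCDF_coe] at hx
  exact not_le.1 fun hle => hx.not_ge ((stdNormalQuantile_le_iff (hu x) _).1 hle)

/-- The values `a x` may already be `⊤`, so the limit comes from monotonicity: `a x > M * s + m`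
forces the quotient to be at least `M`. -/
lemma tendsto_stdNormalCDF_sub_div {α : Type*} {l : Filter α} {a : α → EReal}
    (h : Tendsto a l (𝓝 ⊤)) (m : ℝ) {s : ℝ} (hs : 0 < s) :
    Tendsto (fun x => stdNormalCDF ((a x - (m : EReal)) / (s : EReal))) l (𝓝 1) := by
  refine tendsto_order.2 ⟨fun v hv => ?_, fun v hv =>
    Eventually.of_forall fun x => (stdNormalCDF_le_one _).trans_lt hv⟩
  obtain ⟨M, hM⟩ := ((tendsto_cdf_atTop (gaussianReal 0 1)).eventually (lt_mem_nhds hv)).exists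
  rw [← stdNormalCDF_coe] at hM
  filter_upwards [EReal.tendsto_nhds_top_iff_real.1 h (M * s + m)] with x hx
  refine hM.trans_le (stdNormalCDF_mono ?_)
  rw [EReal.le_div_iff_mul_le (EReal.coe_pos.2 hs) (EReal.coe_ne_top s),
    EReal.le_sub_iff_add_le (Or.inl (EReal.coe_ne_bot m)) (Or.inl (EReal.coe_ne_top m)),
    ← EReal.coe_mul, ← EReal.coe_add]
  exact hx.le

lemma riskVector_preimage {Ω : Type*} (R Nplus : Ω → ℕ) (Y : ℕ → Ω → ℝ) (B : Set (Σ n : ℕ, (Fin n → ℝ))) :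
    riskVector R Nplus Y ⁻¹' B =
      ⋃ n, {ω | freq R Nplus ω = n ∧ firstSev Y n ω ∈ Sigma.mk n ⁻¹' B} := by
  ext ω
  simp [riskVector]

lemma BernoulliHurdle.measure_eq_one {Ω : Type*} [MeasurableSpace Ω] {P : Measure Ω}
    {K : ℕ∞} {Nplus : Ω → ℕ} {Y : ℕ → Ω → ℝ} {p : unitInterval} {R : Ω → ℕ}
    (hh : BernoulliHurdle P p K R Nplus Y) : P {ω | R ω = 1} = ENNReal.ofReal p := by
  classical
  have h := Measure.map_apply (μ := P) hh.measurable (measurableSet_singleton 1)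
  rw [hh.bernoulli.map_eq, bernoulliMeasure_apply _ (measurableSet_singleton 1)] at h
  refine h.symm.trans ?_
  rw [ENNReal.ofReal_eq_coe_nnreal p.2.1]
  simp
  rfl

section Model

variable {Ω : Type*} [MeasurableSpace Ω] {P : Measure Ω} [IsProbabilityMeasure P]
  {z : CorrType} {ρ₁ ρ₂ : ℝ} {K : ℕ∞} {f₂ : ℝ → ℝ} {Nplus : Ω → ℕ} {Y : ℕ → Ω → ℝ}

lemma freqCDF_mono (P : Measure Ω) (Nplus : Ω → ℕ) : Monotone (freqCDF P Nplus) :=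
  monotone_cdf _

lemma measurable_firstSev (hY : ∀ j, Measurable (Y j)) (k : ℕ) : Measurable (firstSev Y k) :=
  measurable_pi_iff.2 fun i => hY i

/-- For fixed `x`, the joint distribution function as a function of `y` gives the lower-box values
of a finite measure, the law of `Y^[k]` on `{N⁺ ≤ x}`. -/
lemma GaussianConditionalModel.map_firstSev_restrict_le
    (h : GaussianConditionalModel P z ρ₁ ρ₂ K f₂ Nplus Y) {k : ℕ} (hk : 1 ≤ k)
    (hkK : (k : ℕ∞) ≤ K) (x : ℝ) :
    (P.restrict {ω | (Nplus ω : ℝ) ≤ x}).map (firstSev Y k) =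
      volume.withDensity fun y => ENNReal.ofReal
        (sevJointDensity z ρ₂ f₂ k y * condFreqCDF z ρ₁ ρ₂ (freqCDF P Nplus) f₂ k x y) := by
  refine ext_of_pi_Iic fun y => ?_
  have hbox : MeasurableSet (Set.univ.pi fun i => Set.Iic (y i)) :=
    MeasurableSet.univ_pi fun i => measurableSet_Iic
  have hY := measurable_firstSev h.measurable_sev k
  rw [Measure.map_apply hY hbox, Measure.restrict_apply (hY hbox), withDensity_apply _ hbox]
  have hset : firstSev Y k ⁻¹' (Set.univ.pi fun i => Set.Iic (y i)) ∩ {ω | (Nplus ω : ℝ) ≤ x} =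
      {ω | (Nplus ω : ℝ) ≤ x ∧ ∀ i, firstSev Y k ω i ≤ y i} := by
    ext ω; simp [and_comm, Pi.le_def]
  rw [hset, ← ofReal_measureReal, h.joint_cdf k hk hkK,
    gaussianCopula_cons_eq_lintegral (h.admissible.posDef_jointCorr hkK) h.sevDensity]
  rfl

/-- As `N⁺` is integer-valued, `{N⁺ = n}` is `{N⁺ ≤ n}` minus `{N⁺ ≤ n - 1}`. The subtraction is
done by cancelling a finite summand in `ENNReal`. -/
lemma GaussianConditionalModel.measure_freq_eq_inter
    (h : GaussianConditionalModel P z ρ₁ ρ₂ K f₂ Nplus Y) {k : ℕ} (hk : 1 ≤ k)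
    (hkK : (k : ℕ∞) ≤ K) (n : ℕ) {A : Set (Fin k → ℝ)} (hA : MeasurableSet A) :
    P {ω | Nplus ω = n ∧ firstSev Y k ω ∈ A} =
      ∫⁻ y in A, ENNReal.ofReal (mixedDensity z ρ₁ ρ₂ (freqCDF P Nplus) f₂ k n y) := by
  have hY := measurable_firstSev h.measurable_sev k
  have hle : ∀ x : ℝ, P (firstSev Y k ⁻¹' A ∩ {ω | (Nplus ω : ℝ) ≤ x}) =
      ∫⁻ y in A, ENNReal.ofReal
        (sevJointDensity z ρ₂ f₂ k y * condFreqCDF z ρ₁ ρ₂ (freqCDF P Nplus) f₂ k x y) := by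
    intro x
    rw [← Measure.restrict_apply (hY hA), ← Measure.map_apply hY hA,
      h.map_firstSev_restrict_le hk hkK, withDensity_apply _ hA]
  have hunion : firstSev Y k ⁻¹' A ∩ {ω | (Nplus ω : ℝ) ≤ n} =
      (firstSev Y k ⁻¹' A ∩ {ω | (Nplus ω : ℝ) ≤ n - 1}) ∪
        {ω | Nplus ω = n ∧ firstSev Y k ω ∈ A} := by
    ext ω
    have hiff : (Nplus ω : ℝ) ≤ n ↔ (Nplus ω : ℝ) ≤ n - 1 ∨ Nplus ω = n := by
      rw [le_sub_iff_add_le]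
      norm_cast
      omega
    simp only [Set.mem_inter_iff, Set.mem_preimage, Set.mem_ofPred_eq, Set.mem_union, hiff]
    tauto
  have hdisj : Disjoint (firstSev Y k ⁻¹' A ∩ {ω | (Nplus ω : ℝ) ≤ n - 1})
      {ω | Nplus ω = n ∧ firstSev Y k ω ∈ A} := by
    rw [Set.disjoint_left]
    rintro ω ⟨-, h1⟩ ⟨h2, -⟩
    have h1 : (Nplus ω : ℝ) ≤ n - 1 := h1
    rw [h2] at h1
    linarith
  have hmeas : MeasurableSet {ω | Nplus ω = n ∧ firstSev Y k ω ∈ A} :=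
    (h.measurable_freq (measurableSet_singleton n)).inter (hY hA)
  have hsum := hle n
  rw [hunion, measure_union hdisj hmeas, hle] at hsum
  have hint : ∫⁻ y in A, ENNReal.ofReal
        (sevJointDensity z ρ₂ f₂ k y * condFreqCDF z ρ₁ ρ₂ (freqCDF P Nplus) f₂ k n y) =
      (∫⁻ y in A, ENNReal.ofReal
        (sevJointDensity z ρ₂ f₂ k y * condFreqCDF z ρ₁ ρ₂ (freqCDF P Nplus) f₂ k (n - 1) y)) +
      ∫⁻ y in A, ENNReal.ofReal (mixedDensity z ρ₁ ρ₂ (freqCDF P Nplus) f₂ k n y) := by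
    rw [← lintegral_add_right _ (measurable_mixedDensity z ρ₁ ρ₂ _
      h.sevDensity.measurable k n).ennreal_ofReal]
    refine lintegral_congr fun y => ?_
    have h0 : 0 ≤ sevJointDensity z ρ₂ f₂ k y *
        condFreqCDF z ρ₁ ρ₂ (freqCDF P Nplus) f₂ k (n - 1) y :=
      mul_nonneg (sevJointDensity_nonneg z ρ₂ h.sevDensity.nonneg k y) (stdNormalCDF_nonneg _)
    rw [← ENNReal.ofReal_add h0 (mixedDensity_nonneg z ρ₁ ρ₂ (freqCDF_mono P Nplus)
        h.sevDensity.nonneg k n y)]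
    congr 1
    rw [mixedDensity]
    ring
  rw [hint] at hsum
  refine (ENNReal.add_right_inj ?_).1 hsum
  rw [← hle]
  exact measure_ne_top _ _

/-- Let `n` tend to infinity in the law on `{N⁺ ≤ n}`: continuity of measure on one side, monotone
convergence on the other, as the conditional distribution function increases to `1`. -/
lemma GaussianConditionalModel.map_firstSev
    (h : GaussianConditionalModel P z ρ₁ ρ₂ K f₂ Nplus Y) {k : ℕ} (hk : 1 ≤ k)
    (hkK : (k : ℕ∞) ≤ K) :
    P.map (firstSev Y k) =
      volume.withDensity fun y => ENNReal.ofReal (sevJointDensity z ρ₂ f₂ k y) := by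
  have hY := measurable_firstSev h.measurable_sev k
  have hprob : IsProbabilityMeasure (P.map fun ω => (Nplus ω : ℝ)) :=
    Measure.isProbabilityMeasure_map
      ((measurable_from_top (f := fun n : ℕ => (n : ℝ))).comp h.measurable_freq).aemeasurable
  ext A hA
  rw [Measure.map_apply hY hA, withDensity_apply _ hA]
  have hle : ∀ n : ℕ, P (firstSev Y k ⁻¹' A ∩ {ω | (Nplus ω : ℝ) ≤ n}) =
      ∫⁻ y in A, ENNReal.ofReal
        (sevJointDensity z ρ₂ f₂ k y * condFreqCDF z ρ₁ ρ₂ (freqCDF P Nplus) f₂ k n y) := by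
    intro n
    rw [← Measure.restrict_apply (hY hA), ← Measure.map_apply hY hA,
      h.map_firstSev_restrict_le hk hkK, withDensity_apply _ hA]
  have hunion : firstSev Y k ⁻¹' A =
      ⋃ n : ℕ, firstSev Y k ⁻¹' A ∩ {ω | (Nplus ω : ℝ) ≤ n} := by
    rw [← Set.inter_iUnion, eq_comm, Set.inter_eq_left]
    exact fun ω _ => Set.mem_iUnion.2 ⟨Nplus ω, le_refl (Nplus ω : ℝ)⟩
  have hleft : Tendsto (fun n : ℕ => P (firstSev Y k ⁻¹' A ∩ {ω | (Nplus ω : ℝ) ≤ n})) atTop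
      (𝓝 (P (firstSev Y k ⁻¹' A))) := by
    conv => rhs; rw [hunion]
    refine tendsto_measure_iUnion_atTop fun m n hmn ω hω => ⟨hω.1, ?_⟩
    exact le_trans (α := ℝ) hω.2 (Nat.cast_le.2 hmn)
  have hright : Tendsto (fun n : ℕ => ∫⁻ y in A, ENNReal.ofReal
        (sevJointDensity z ρ₂ f₂ k y * condFreqCDF z ρ₁ ρ₂ (freqCDF P Nplus) f₂ k n y)) atTop
      (𝓝 (∫⁻ y in A, ENNReal.ofReal (sevJointDensity z ρ₂ f₂ k y))) := by
    refine lintegral_tendsto_of_tendsto_of_monotone (fun n =>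
      ((measurable_sevJointDensity z ρ₂ h.sevDensity.measurable k).mul
        (measurable_condFreqCDF z ρ₁ ρ₂ _ f₂ k n)).ennreal_ofReal.aemeasurable)
      (ae_of_all _ fun y m n hmn => ?_) (ae_of_all _ fun y => ?_)
    · exact ENNReal.ofReal_le_ofReal (mul_le_mul_of_nonneg_left
        (condFreqCDF_mono z ρ₁ ρ₂ (freqCDF_mono P Nplus) f₂ k y (Nat.cast_le.2 hmn))
        (sevJointDensity_nonneg z ρ₂ h.sevDensity.nonneg k y))
    · have h1 : Tendsto (fun n : ℕ => condFreqCDF z ρ₁ ρ₂ (freqCDF P Nplus) f₂ k n y) atTop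
          (𝓝 1) :=
        tendsto_stdNormalCDF_sub_div (tendsto_stdNormalQuantile (fun _ => cdf_le_one _ _)
          ((tendsto_cdf_atTop _).comp tendsto_natCast_atTop_atTop)) _
          (condSD_pos (h.admissible.posDef_jointCorr hkK))
      simpa using ENNReal.tendsto_ofReal (h1.const_mul (sevJointDensity z ρ₂ f₂ k y))
  exact tendsto_nhds_unique hleft (hright.congr fun n => (hle n).symm)

lemma GaussianConditionalModel.isDensityOf_firstSev
    (h : GaussianConditionalModel P z ρ₁ ρ₂ K f₂ Nplus Y) {k : ℕ} (hk : 1 ≤ k)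
    (hkK : (k : ℕ∞) ≤ K) :
    IsDensityOf (sevJointDensity z ρ₂ f₂ k) (firstSev Y k) P volume where
  measurable := measurable_sevJointDensity z ρ₂ h.sevDensity.measurable k
  nonneg := sevJointDensity_nonneg z ρ₂ h.sevDensity.nonneg k
  hasLaw := ⟨(measurable_firstSev h.measurable_sev k).aemeasurable, h.map_firstSev hk hkK⟩

lemma GaussianConditionalModel.freqCDF_eq_one
    (h : GaussianConditionalModel P z ρ₁ ρ₂ K f₂ Nplus Y) {n : ℕ} (hn : K ≤ n) {x : ℝ}
    (hx : n ≤ x) : freqCDF P Nplus x = 1 := by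
  have hm : Measurable fun ω => (Nplus ω : ℝ) :=
    (measurable_from_top (f := fun n : ℕ => (n : ℝ))).comp h.measurable_freq
  have := Measure.isProbabilityMeasure_map (μ := P) hm.aemeasurable
  rw [freqCDF, cdf_eq_real, measureReal_def, Measure.map_apply hm measurableSet_Iic]
  have hae : ∀ᵐ ω ∂P, ω ∈ (fun ω => (Nplus ω : ℝ)) ⁻¹' Set.Iic x := by
    filter_upwards [h.freq_le] with ω hω
    have h1 : Nplus ω ≤ n := by exact_mod_cast hω.trans hn
    exact (Nat.cast_le.2 h1 : (Nplus ω : ℝ) ≤ n).trans hx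
  rw [(mem_ae_iff_prob_eq_one (hm measurableSet_Iic)).1 hae, ENNReal.toReal_one]

/-! ### The dependent collective risk model -/

/-- The σ-algebra on a disjoint union is the largest one making every inclusion `Sigma.mk a`
measurable, so measurability is tested on each summand. -/
lemma measurable_sigma_iff {α β : Type*} {γ : α → Type*} [∀ a, MeasurableSpace (γ a)]
    [MeasurableSpace β] {f : (Σ a, γ a) → β} :
    Measurable f ↔ ∀ a, Measurable fun y => f ⟨a, y⟩ := by
  refine ⟨fun h a s hs => ?_, fun h s hs => ?_⟩
  · exact MeasurableSpace.measurableSet_iInf.1 (h hs) a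
  · exact MeasurableSpace.measurableSet_iInf.2 fun a => h a hs

lemma measurable_sigmaMk {α : Type*} {γ : α → Type*} [∀ a, MeasurableSpace (γ a)] (a : α) :
    Measurable (Sigma.mk a : γ a → Σ a, γ a) := fun _ hs =>
  MeasurableSpace.measurableSet_iInf.1 hs a

lemma measurable_riskDensity (z : CorrType) (ρ₁ ρ₂ : ℝ) (p : unitInterval) (F₁ : ℝ → ℝ)
    {f₂ : ℝ → ℝ} (hf : Measurable f₂) : Measurable (riskDensity z ρ₁ ρ₂ p F₁ f₂) := by
  refine measurable_sigma_iff.2 fun n => ?_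
  by_cases hn : n = 0
  · simp [riskDensity, hn]
  · simpa [riskDensity, hn] using (measurable_mixedDensity z ρ₁ ρ₂ F₁ hf n n).const_mul (p : ℝ)

lemma riskDensity_nonneg (z : CorrType) (ρ₁ ρ₂ : ℝ) (p : unitInterval) {F₁ : ℝ → ℝ}
    (hF : Monotone F₁) {f₂ : ℝ → ℝ} (hf : ∀ y, 0 ≤ f₂ y) (v : Σ n : ℕ, (Fin n → ℝ)) :
    0 ≤ riskDensity z ρ₁ ρ₂ p F₁ f₂ v := by
  unfold riskDensity
  split_ifs
  · exact sub_nonneg.2 p.2.2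
  · exact mul_nonneg p.2.1 (mixedDensity_nonneg z ρ₁ ρ₂ hF hf _ _ _)

variable {p : unitInterval} {R : Ω → ℕ}

lemma measurable_freq (hR : Measurable R) (hN : Measurable Nplus) : Measurable (freq R Nplus) :=
  Measurable.ite (hR (measurableSet_singleton 1)) hN measurable_const

lemma measurableSet_freq_eq_inter (hR : Measurable R) (hN : Measurable Nplus)
    (hY : ∀ j, Measurable (Y j)) (n : ℕ) {B : Set (Σ n : ℕ, (Fin n → ℝ))} (hB : MeasurableSet B) :
    MeasurableSet {ω | freq R Nplus ω = n ∧ firstSev Y n ω ∈ Sigma.mk n ⁻¹' B} :=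
  (measurable_freq hR hN (measurableSet_singleton n)).inter
    (measurable_firstSev hY n (measurable_sigmaMk n hB))

lemma measurable_riskVector (hR : Measurable R) (hN : Measurable Nplus)
    (hY : ∀ j, Measurable (Y j)) : Measurable (riskVector R Nplus Y) := fun B hB => by
  rw [riskVector_preimage]
  exact MeasurableSet.iUnion fun n => measurableSet_freq_eq_inter hR hN hY n hB

lemma measure_freq_eq_zero (h : GaussianConditionalModel P z ρ₁ ρ₂ K f₂ Nplus Y)
    (hh : BernoulliHurdle P p K R Nplus Y) :
    P {ω | freq R Nplus ω = 0} = ENNReal.ofReal (1 - p) := by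
  have hR : MeasurableSet {ω | R ω = 1} := hh.measurable (measurableSet_singleton 1)
  have hae : {ω | freq R Nplus ω = 0} =ᵐ[P] ({ω | R ω = 1}ᶜ : Set Ω) := by
    -- Since `N⁺ ≥ 1` almost surely, `N = 0` can only come from `R ≠ 1`.
    filter_upwards [h.freq_pos] with ω hω
    refine propext ?_
    change freq R Nplus ω = 0 ↔ ¬ R ω = 1
    by_cases hr : R ω = 1 <;> simp [freq, hr]
    omega
  rw [measure_congr hae, prob_compl_eq_one_sub hR, hh.measure_eq_one,
    ENNReal.ofReal_sub _ p.2.1, ENNReal.ofReal_one]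

lemma measure_freq_eq_inter (h : GaussianConditionalModel P z ρ₁ ρ₂ K f₂ Nplus Y)
    (hh : BernoulliHurdle P p K R Nplus Y) {n : ℕ} (hn : 1 ≤ n) {A : Set (Fin n → ℝ)}
    (hA : MeasurableSet A) :
    P {ω | freq R Nplus ω = n ∧ firstSev Y n ω ∈ A} = ∫⁻ y in A, ENNReal.ofReal
      (p * mixedDensity z ρ₁ ρ₂ (freqCDF P Nplus) f₂ n n y) := by
  have hset : {ω | freq R Nplus ω = n ∧ firstSev Y n ω ∈ A} =
      {ω | R ω = 1} ∩ {ω | Nplus ω = n ∧ firstSev Y n ω ∈ A} := by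
    ext ω
    by_cases hr : R ω = 1 <;> simp [freq, hr]
    omega
  rw [hset]
  by_cases hnK : (n : ℕ∞) ≤ K
  · have hpair : {ω | Nplus ω = n ∧ firstSev Y n ω ∈ A} =
        (fun ω => (Nplus ω, firstSev Y n ω)) ⁻¹' (({n} : Set ℕ) ×ˢ A) := by
      ext ω; simp
    have hind : P ({ω | R ω = 1} ∩ {ω | Nplus ω = n ∧ firstSev Y n ω ∈ A}) =
        P {ω | R ω = 1} * P {ω | Nplus ω = n ∧ firstSev Y n ω ∈ A} := by
      rw [hpair]
      exact (hh.indep n hn hnK).measure_inter_preimage_eq_mul {1} _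
        (measurableSet_singleton 1) ((measurableSet_singleton n).prod hA)
    rw [hind, hh.measure_eq_one, h.measure_freq_eq_inter hn hnK n hA,
      ← lintegral_const_mul' _ _ ENNReal.ofReal_ne_top]
    exact lintegral_congr fun y => (ENNReal.ofReal_mul p.2.1).symm
  -- Beyond the bound both sides vanish: `K < n` gives `K ≤ n - 1`, so `F₁⁺` equals `1` at both `n`
  -- and `n - 1`, while `{N⁺ = n}` is null.
  · have hKn : K ≤ ((n - 1 : ℕ) : ℕ∞) := by
      have : K < ((n - 1 + 1 : ℕ) : ℕ∞) := by rw [Nat.sub_add_cancel hn]; exact not_le.1 hnK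
      exact Order.le_of_lt_add_one (by exact_mod_cast this)
    have hcast : ((n - 1 : ℕ) : ℝ) = n - 1 := by push_cast [hn]; ring
    have h1 : freqCDF P Nplus n = 1 := h.freqCDF_eq_one hKn (by rw [hcast]; linarith)
    have h2 : freqCDF P Nplus (n - 1) = 1 := h.freqCDF_eq_one hKn hcast.le
    have hzero : ∀ y, mixedDensity z ρ₁ ρ₂ (freqCDF P Nplus) f₂ n n y = 0 := by
      intro y
      rw [mixedDensity, condFreqCDF, condFreqCDF, h1, h2, sub_self, mul_zero]
    simp only [hzero, mul_zero, ENNReal.ofReal_zero, lintegral_zero]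
    have hnull : P {ω | Nplus ω = n} = 0 := by
      refine measure_mono_null (fun ω hω => ?_) (ae_iff.1 h.freq_le)
      have hω : Nplus ω = n := hω
      simpa [hω] using hnK
    exact measure_mono_null (fun ω hω => hω.2.1) hnull

/-- Both measures split as countable sums over `n`: the law by the value of `N`, the reference
measure by definition. The terms are then compared one by one. -/
lemma map_riskVector (h : GaussianConditionalModel P z ρ₁ ρ₂ K f₂ Nplus Y)
    (hh : BernoulliHurdle P p K R Nplus Y) :
    P.map (riskVector R Nplus Y) = mixedVolume.withDensity fun v =>
      ENNReal.ofReal (riskDensity z ρ₁ ρ₂ p (freqCDF P Nplus) f₂ v) := by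
  ext B hB
  have hdens := (measurable_riskDensity z ρ₁ ρ₂ p (freqCDF P Nplus)
    h.sevDensity.measurable).ennreal_ofReal
  rw [Measure.map_apply (measurable_riskVector hh.measurable h.measurable_freq h.measurable_sev) hB,
    riskVector_preimage, measure_iUnion
      (fun m n hmn => Set.disjoint_left.2 fun ω hm hn => hmn (hm.1.symm.trans hn.1))
      (fun n => measurableSet_freq_eq_inter hh.measurable h.measurable_freq h.measurable_sev n hB),
    withDensity_apply _ hB, mixedVolume, Measure.restrict_sum _ hB, lintegral_sum_measure]
  refine tsum_congr fun n => ?_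
  rw [setLIntegral_map hB hdens (measurable_sigmaMk n)]
  rcases Nat.eq_zero_or_pos n with rfl | hn
  · simp only [riskDensity, if_true, setLIntegral_const]
    -- `ℝ⁰` is a single point of volume `1`, so the slice of `B` is either empty or everything.
    rcases Set.eq_empty_or_nonempty (Sigma.mk (β := fun n => Fin n → ℝ) 0 ⁻¹' B) with hempty | hne
    · simp [hempty]
    · rw [Subsingleton.eq_univ_of_nonempty hne]
      have hvol : (volume : Measure (Fin 0 → ℝ)) Set.univ = 1 := by
        rw [volume_pi, Measure.pi_of_empty]; simp
      rw [hvol, mul_one, ← measure_freq_eq_zero h hh]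
      simp
  · simp only [riskDensity, if_neg hn.ne']
    exact measure_freq_eq_inter h hh hn (measurable_sigmaMk n hB)

end Model

end RiskModel
end

theorem theorem3 {Ω : Type*} [MeasurableSpace Ω] (P : Measure Ω) [IsProbabilityMeasure P]
    (z : RiskModel.CorrType) (ρ₁ ρ₂ : ℝ) (K : ℕ∞) (f₂ : ℝ → ℝ)
    (Nplus : Ω → ℕ) (Y : ℕ → Ω → ℝ) (p : unitInterval) (R : Ω → ℕ)
    (hmodel : RiskModel.GaussianConditionalModel P z ρ₁ ρ₂ K f₂ Nplus Y)
    (hhurdle : RiskModel.BernoulliHurdle P p K R Nplus Y) :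
    RiskModel.IsDensityOf
        (RiskModel.riskDensity z ρ₁ ρ₂ p (RiskModel.freqCDF P Nplus) f₂)
        (RiskModel.riskVector R Nplus Y) P RiskModel.mixedVolume ∧
      ∀ n : ℕ, 1 ≤ n → (n : ℕ∞) ≤ K →
        RiskModel.IsDensityOf (RiskModel.sevJointDensity z ρ₂ f₂ n)
          (RiskModel.firstSev Y n) P volume := by
  refine ⟨⟨?_, ?_, ?_, ?_⟩, fun n hn hnK => hmodel.isDensityOf_firstSev hn hnK⟩
  · exact RiskModel.measurable_riskDensity z ρ₁ ρ₂ p _ hmodel.sevDensity.measurable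
  · exact RiskModel.riskDensity_nonneg z ρ₁ ρ₂ p (RiskModel.freqCDF_mono P Nplus)
      hmodel.sevDensity.nonneg
  · exact (RiskModel.measurable_riskVector hhurdle.measurable hmodel.measurable_freq
      hmodel.measurable_sev).aemeasurable
  · exact RiskModel.map_riskVector hmodel hhurdle
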